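/- **Theorem 3.** There is a polynomial-sized integer linear programming (ILP) formulation for the feedback vertex set problem (FVS) whose LP-relaxation has integrality gap at most $2$. The witness is the following formulation. Let $G=(V,E)$ be a finite simple undirected graph. Let $$P_{\text{orient}}(G)=\Big\{(x,y):\ x_u+x_v+y_{e,u}+y_{e,v}\ge 1\ \ \forall e=uv\in E;\quad x_u+\sum_{e\in\delta(u)}y_{e,u}\le 1\ \ \forall u\in V;\quad x_u\ge 0\ \ \forall u\in V;\quad y_{e,u}\ge 0\ \ \forall u\in V,\ e\in\delta(u)\Big\},$$ where $\delta(u)$ is the set of edges incident to $u$, let $Q_{\text{orient}}(G)$ be its projection to the $x$ variables, and let $$P_{\text{cycle-cover}}(G)=\Big\{x\in\mathbb R^V_{\ge 0}:\ \sum_{u\in U}x_u\ge 1\ \ \forall U\subseteq V\text{ such that the induced subgraph }G[U]\text{ is a cycle}\Big\}.$$ Let $E'\subseteq E$ be the set of edges that lie on some cycle of $G$, fix for every $e\in E'$ an arbitrary naming $e=st$ of its endpoints, and let $$P_{\text{dist}}(G)=\Big\{(x,d)\in\mathbb R^V_{\ge0}\times\mathbb R^{V\times E'}_{\ge0}:\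 d^e_s=0,\ \ d^e_t+x_s\ge 1\ \ \forall e=st\in E';\quad d^e_a+x_b\ge d^e_b\ \text{ and }\ d^e_b+x_a\ge d^e_a\ \ \forall e\in E',\ ab\in E\setminus\{e\}\Big\}.$$ Then: 1. There is one polynomial $p$ such that, for every $G$ and every naming, the system in the variables $(x,y,d)$ consisting of the inequalities of $P_{\text{orient}}(G)$ and $P_{\text{dist}}(G)$, written as an explicit system of linear inequalities with integer coefficients, has size (number of variables, plus number of inequalities, plus total bit length of all coefficients and right-hand sides) at most $p(|V|)$. 2. The projection of $P_{\text{dist}}(G)$ to the $x$ variables is $P_{\text{cycle-cover}}(G)$, and the projection of the whole system to the $x$ variables is $Q_{\text{orient}}(G)\cap P_{\text{cycle-cover}}(G)$. 3. The system is an ILP formulation of FVS: the $x$ parts of its integer solutions are exactly the indicator vectors of the feedback vertex sets of $G$ (the sets $S\subseteq V$ such that $G-S$ has no cycle), and these are also exactly the points of $Q_{\text{orient}}(G)\cap P_{\text{cycle-cover}}(G)\cap\mathbb Z^V$. 4. The integrality gap is at most $2$: for all costs $c:V\to\mathbb R_{\ge0}$, the minimum of $\sum_{u\in V}c_ux_u$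 over the integer solutions of the system is attained and equals the minimum cost of a feedback vertex set of $G$, the minimum of $\sum_{u\in V}c_ux_u$ over the real solutions (the LP-relaxation) is attained, and the former is at most twice the latter. -/

import Mathlib

universe u v w

namespace FVS

/-! ### Integer linear systems -/

/-- A finite system of linear inequalities `A z ≥ b` with integer data, in variables indexed by `ι`
and with inequalities indexed by `κ`. -/
structure LinearSystem (ι : Type u) (κ : Type v) where
  A : Matrix κ ι ℤ
  b : κ → ℤ

namespace LinearSystem

variable {ι : Type u} {κ : Type v}

/-- The real solutions of the system: the feasible region of the LP-relaxation. -/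
def polyhedron [Fintype ι] (S : LinearSystem ι κ) : Set (ι → ℝ) :=
  {z | ∀ k, (S.b k : ℝ) ≤ ∑ i, (S.A k i : ℝ) * z i}

/-- The integer solutions of the system: the feasible region of the ILP (all variables are
integral). -/
def integerPoints [Fintype ι] (S : LinearSystem ι κ) : Set (ι → ℝ) :=
  {z | z ∈ S.polyhedron ∧ ∀ i, ∃ m : ℤ, z i = m}

/-- The size of the system: the number of variables, plus the number of inequalities, plus the
total number of bits (a sign bit included) of all entries of `A` and `b`. -/
def size [Fintype ι] [Fintype κ] (S : LinearSystem ι κ) : ℕ :=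
  Fintype.card ι + Fintype.card κ +
    ∑ k, ((∑ i, ((S.A k i).natAbs.size + 1)) + ((S.b k).natAbs.size + 1))

end LinearSystem

/-! ### Graph notions -/

variable {V : Type u}

/-- `S` is a feedback vertex set of `G`: the graph `G - S` has no cycle. -/
def IsFeedbackVertexSet (G : SimpleGraph V) (S : Finset V) : Prop :=
  (G.induce {v | v ∉ S}).IsAcyclic

/-- The indicator vector of a set of vertices. -/
def indicatorVector [DecidableEq V] (S : Finset V) : V → ℝ :=
  fun u => if u ∈ S then 1 else 0

/-- The graph `H` is a cycle: some cycle in `H` uses all vertices and all edges of `H`. -/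
def IsCycleGraph {W : Type u} (H : SimpleGraph W) : Prop :=
  ∃ (a : W) (p : H.Walk a a), p.IsCycle ∧ p.toSubgraph = ⊤

/-- The set `E'` of the edges of `G` that lie on a cycle of `G`. -/
abbrev CycleEdge (G : SimpleGraph V) : Type u :=
  {e : Sym2 V // ∃ (a : V) (p : G.Walk a a), p.IsCycle ∧ e ∈ p.edges}

noncomputable instance [Fintype V] (G : SimpleGraph V) : Fintype (CycleEdge G) :=
  Fintype.ofFinite _

/-- A naming `e = st` of the two endpoints of every edge `e ∈ E'`. -/
structure EndpointNaming (G : SimpleGraph V) where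
  s : CycleEdge G → V
  t : CycleEdge G → V
  eq_edge : ∀ e : CycleEdge G, s(s e, t e) = (e : Sym2 V)

/-! ### The polyhedra

A dart `a` of `G` is an ordered pair of adjacent vertices. The variable `y_{e,u}` with `e = uv` an
edge at `u` is indexed by the dart `(u, v)`; so `y_{e,v}` is indexed by the reversed dart. -/

/-- The orientation polyhedron. -/
def orientPolyhedron [Fintype V] [DecidableEq V] (G : SimpleGraph V) [DecidableRel G.Adj] :
    Set ((V → ℝ) × (G.Dart → ℝ)) :=
  {q | (∀ a : G.Dart, 1 ≤ q.1 a.fst + q.1 a.snd + q.2 a + q.2 a.symm) ∧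
    (∀ u : V, q.1 u + ∑ a : G.Dart with a.fst = u, q.2 a ≤ 1) ∧
    (∀ u : V, 0 ≤ q.1 u) ∧
    (∀ a : G.Dart, 0 ≤ q.2 a)}

/-- The projection of the orientation polyhedron to the `x` variables. -/
def orientProjection [Fintype V] [DecidableEq V] (G : SimpleGraph V) [DecidableRel G.Adj] :
    Set (V → ℝ) :=
  Prod.fst '' orientPolyhedron G

/-- The cycle cover polyhedron. -/
def cycleCoverPolyhedron (G : SimpleGraph V) : Set (V → ℝ) :=
  {x | (∀ u : V, 0 ≤ x u) ∧
    ∀ U : Finset V, IsCycleGraph (G.induce (U : Set V)) → 1 ≤ ∑ u ∈ U, x u}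

/-- The distance polyhedron; `q.2 (a, e)` is the distance variable `d^e_a`. The triangle
inequalities are imposed in both directions along every edge `ab` of `G` other than `e`. -/
def distPolyhedron (G : SimpleGraph V) (o : EndpointNaming G) :
    Set ((V → ℝ) × (V × CycleEdge G → ℝ)) :=
  {q | (∀ u : V, 0 ≤ q.1 u) ∧
    (∀ i : V × CycleEdge G, 0 ≤ q.2 i) ∧
    (∀ e : CycleEdge G, q.2 (o.s e, e) = 0) ∧
    (∀ e : CycleEdge G, 1 ≤ q.2 (o.t e, e) + q.1 (o.s e)) ∧
    (∀ (a : G.Dart) (e : CycleEdge G), a.edge ≠ (e : Sym2 V) →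
      q.2 (a.snd, e) ≤ q.2 (a.fst, e) + q.1 a.snd)}

/-! ### The explicit integer linear program -/

/-- The variables: `x_u`, `y_{e,u}` and `d^e_a`. -/
abbrev Var (G : SimpleGraph V) : Type u :=
  V ⊕ (G.Dart ⊕ (V × CycleEdge G))

/-- The inequalities: non-negativity of all variables; edge constraints; vertex constraints;
`d^e_s ≤ 0`; `d^e_t + x_s ≥ 1`; the triangle inequalities. -/
abbrev Con (G : SimpleGraph V) : Type u :=
  Var G ⊕ (G.Dart ⊕ (V ⊕ (CycleEdge G ⊕ (CycleEdge G ⊕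
    {i : G.Dart × CycleEdge G // i.1.edge ≠ (i.2 : Sym2 V)}))))

section Rows

variable [DecidableEq V] (G : SimpleGraph V)

/-- The coefficient vector of the variable `x_u`. -/
def xVar (u : V) : Var G → ℤ := Pi.single (Sum.inl u) 1

/-- The coefficient vector of the variable `y_{e,u}`, `a` being the dart from `u` along `e`. -/
def yVar (a : G.Dart) : Var G → ℤ := Pi.single (Sum.inr (Sum.inl a)) 1

/-- The coefficient vector of the variable `d^e_a`. -/
def dVar (a : V) (e : CycleEdge G) : Var G → ℤ := Pi.single (Sum.inr (Sum.inr (a, e))) 1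

end Rows

section ILP

variable [Fintype V] [DecidableEq V] (G : SimpleGraph V) [DecidableRel G.Adj]

/-- The left-hand side of each inequality. -/
def row (o : EndpointNaming G) : Con G → Var G → ℤ
  | .inl i => Pi.single i 1
  | .inr (.inl a) => xVar G a.fst + xVar G a.snd + yVar G a + yVar G a.symm
  | .inr (.inr (.inl u)) => -xVar G u - ∑ a : G.Dart with a.fst = u, yVar G a
  | .inr (.inr (.inr (.inl e))) => -dVar G (o.s e) e
  | .inr (.inr (.inr (.inr (.inl e)))) => dVar G (o.t e) e + xVar G (o.s e)
  | .inr (.inr (.inr (.inr (.inr i)))) =>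
      dVar G i.1.1.fst i.1.2 + xVar G i.1.1.snd - dVar G i.1.1.snd i.1.2

/-- The right-hand side of each inequality. -/
def rhs : Con G → ℤ
  | .inl _ => 0
  | .inr (.inl _) => 1
  | .inr (.inr (.inl _)) => -1
  | .inr (.inr (.inr (.inl _))) => 0
  | .inr (.inr (.inr (.inr (.inl _)))) => 1
  | .inr (.inr (.inr (.inr (.inr _)))) => 0

/-- The orientation and cycle cover system of `G`. -/
def system (o : EndpointNaming G) : LinearSystem (Var G) (Con G) where
  A := Matrix.of (row G o)
  b := rhs G

end ILP

/-- The `x` part of a vector of variables. -/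
def xPart {G : SimpleGraph V} (z : Var G → ℝ) : V → ℝ := fun u => z (.inl u)

/-- The `y` part of a vector of variables. -/
def yPart {G : SimpleGraph V} (z : Var G → ℝ) : G.Dart → ℝ := fun a => z (.inr (.inl a))

/-- The `d` part of a vector of variables. -/
def dPart {G : SimpleGraph V} (z : Var G → ℝ) : V × CycleEdge G → ℝ :=
  fun i => z (.inr (.inr i))

/-- The cost `∑ c_u x_u`. -/
def cost [Fintype V] (c x : V → ℝ) : ℝ := ∑ u, c u * x u

end FVS

namespace FVS

/-! ### Cores: cycles expressed through degrees -/

section Core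

variable {V : Type*}

/-! Cycles are handled through cores, nonempty vertex sets inducing minimum degree at least two. A
set is a feedback vertex set iff it meets every core, and an inclusion-minimal core induces a cycle,
so the arguments reduce to counting degrees.

The gap bound is a local ratio argument. Write d(v) for the degree of v in G[W]. Summing the edge
and vertex constraints of the orientation polyhedron over W gives the weak density inequality ∑_W
(d(v) - 2) ≤ 2 ∑_W (d(v) - 1) x_v (`weak_density`). If G[W] has minimum degree at least two and no
semidisjoint cycle, every minimal feedback vertex set F of it satisfies ∑_F (d(v) - 1) ≤ ∑_W (d(v) -
2) (`IsMinimalHitting.sum_degIn_le`). So under the weights d(v) - 1 every minimal F costs at most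
twice what x costs. On a semidisjoint cycle, F uses at most one vertex while x has weight at least
one, so the indicator weights of the cycle work as well. Subtracting multiples of such weights from
c until a cost vanishes, deleting that vertex, and reinserting it only if needed yields a minimal F
of cost at most twice that of x (`exists_isMinimalHitting_sum_le`).

For exactness of the formulation, the forest left by a feedback vertex set can be oriented with at
most one edge assigned to each vertex, which gives an integral y. Shortest-path distances avoiding
e, capped at 1, give d, and rounding them down keeps them feasible when x is integral. -/

open Classical in
/-- The number of neighbours of `v` in `A`. -/
noncomputable def degIn (G : SimpleGraph V) (A : Finset V) (v : V) : ℕ :=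
  (A.filter (G.Adj v)).card

/-- A nonempty set of vertices that induces a subgraph of minimum degree at least two. -/
def IsCore (G : SimpleGraph V) (U : Finset V) : Prop :=
  U.Nonempty ∧ ∀ v ∈ U, 2 ≤ degIn G U v

open Classical in
theorem degIn_eq_sum (G : SimpleGraph V) (A : Finset V) (v : V) :
    degIn G A v = ∑ w ∈ A, if G.Adj v w then 1 else 0 := by
  rw [degIn, Finset.card_filter]

theorem degIn_mono (G : SimpleGraph V) {A B : Finset V} (h : A ⊆ B) (v : V) :
    degIn G A v ≤ degIn G B v := by
  classical
  exact Finset.card_le_card (Finset.filter_subset_filter _ h)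

theorem degIn_mono_graph {G H : SimpleGraph V} (h : G ≤ H) (A : Finset V) (v : V) :
    degIn G A v ≤ degIn H A v := by
  classical
  exact Finset.card_le_card fun w hw => by
    simp only [Finset.mem_filter] at hw ⊢
    exact ⟨hw.1, h hw.2⟩

theorem degIn_pos {G : SimpleGraph V} {A : Finset V} {v w : V} (hw : w ∈ A) (h : G.Adj v w) :
    1 ≤ degIn G A v := by
  classical
  exact Finset.card_pos.2 ⟨w, by simp [hw, h]⟩

theorem exists_adj_of_degIn_pos {G : SimpleGraph V} {A : Finset V} {v : V}
    (h : 1 ≤ degIn G A v) : ∃ w ∈ A, G.Adj v w := by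
  classical
  obtain ⟨w, hw⟩ := Finset.card_pos.1 h
  exact ⟨w, by simpa using hw⟩

theorem degIn_congr {G : SimpleGraph V} {A B : Finset V} {v : V}
    (h : ∀ w, G.Adj v w → (w ∈ A ↔ w ∈ B)) : degIn G A v = degIn G B v := by
  classical
  unfold degIn
  congr 1
  ext w
  simp only [Finset.mem_filter]
  grind

theorem sum_degIn_comm (G : SimpleGraph V) (A B : Finset V) :
    ∑ v ∈ A, degIn G B v = ∑ w ∈ B, degIn G A w := by
  classical
  simp only [degIn_eq_sum]
  rw [Finset.sum_comm]
  simp only [G.adj_comm]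

theorem degIn_union_disjoint [DecidableEq V] (G : SimpleGraph V) {A B : Finset V}
    (h : Disjoint A B) (v : V) : degIn G (A ∪ B) v = degIn G A v + degIn G B v := by
  classical
  simp only [degIn_eq_sum]
  exact Finset.sum_union h

theorem degIn_sdiff_add [DecidableEq V] (G : SimpleGraph V) {A B : Finset V}
    (h : B ⊆ A) (v : V) : degIn G (A \ B) v + degIn G B v = degIn G A v := by
  classical
  simp only [degIn_eq_sum]
  exact Finset.sum_sdiff h

open Classical in
theorem degIn_erase_add [DecidableEq V] (G : SimpleGraph V) {A : Finset V} {u : V} (h : u ∈ A)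
    (v : V) : degIn G (A.erase u) v + (if G.Adj v u then 1 else 0) = degIn G A v := by
  simp only [degIn_eq_sum]
  exact Finset.sum_erase_add _ _ h

theorem degIn_erase_self [DecidableEq V] (G : SimpleGraph V) {A : Finset V} {u : V} :
    degIn G (A.erase u) u = degIn G A u :=
  degIn_congr fun w hw => by simp [hw.ne']

/-- A core needs two neighbours of each of its vertices; where W offers only two, it must contain
both. -/
theorem IsCore.subset_of_full {G : SimpleGraph V} {U W : Finset V} {z : V} (hU : IsCore G U)
    (hUW : U ⊆ W) (hz : z ∈ U) (hW : degIn G W z = 2) {w : V} (hw : w ∈ W) (h : G.Adj z w) :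
    w ∈ U := by
  classical
  have h1 : U.filter (G.Adj z) = W.filter (G.Adj z) :=
    Finset.eq_of_subset_of_card_le (Finset.filter_subset_filter _ hUW)
      (by have := hU.2 z hz; unfold degIn at *; omega)
  have : w ∈ U.filter (G.Adj z) := by rw [h1]; simp [hw, h]
  exact (Finset.mem_filter.1 this).1

theorem sum_degIn_erase [DecidableEq V] (G : SimpleGraph V) {A : Finset V} {v : V} (hv : v ∈ A) :
    ∑ z ∈ A, degIn G A z = ∑ z ∈ A.erase v, degIn G (A.erase v) z + 2 * degIn G A v := by
  classical
  have h2 : ∑ z ∈ A.erase v, degIn G A z =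
      ∑ z ∈ A.erase v, degIn G (A.erase v) z + degIn G (A.erase v) v := by
    rw [degIn_eq_sum G _ v, ← Finset.sum_add_distrib]
    refine Finset.sum_congr rfl fun z _ => ?_
    rw [← degIn_erase_add G hv z]
    simp only [G.adj_comm]
  rw [degIn_erase_self] at h2
  rw [← Finset.sum_erase_add _ _ hv, h2]
  omega

/-- A set without a core induces a forest. -/
theorem sum_degIn_add_two_le [DecidableEq V] (G : SimpleGraph V) (A : Finset V)
    (hA : A.Nonempty) (hc : ∀ U ⊆ A, ¬ IsCore G U) :
    ∑ v ∈ A, degIn G A v + 2 ≤ 2 * A.card := by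
  classical
  induction hn : A.card using Nat.strong_induction_on generalizing A with
  | _ n ih =>
    subst hn
    have := hc A subset_rfl
    -- `A` itself is not a core, so some vertex has degree at most one; deleting it lowers the
    -- degree sum by at most two.
    simp only [IsCore, hA, true_and, not_forall, not_le] at this
    obtain ⟨v, hv, hd⟩ := this
    have hcard : (A.erase v).card + 1 = A.card := Finset.card_erase_add_one hv
    rcases (A.erase v).eq_empty_or_nonempty with hB | hB
    · have hA1 : A = {v} := by
        rw [← Finset.insert_erase hv, hB]; rfl
      subst hA1
      simp [degIn, Finset.filter_singleton]
    · have h1 := ih _ (by omega) (A.erase v) hB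
        (fun U hU => hc U (hU.trans (Finset.erase_subset _ _))) rfl
      rw [sum_degIn_erase G hv]
      omega

/-- A set in which all vertices but one have degree at least two contains a core, unless the
exceptional vertex is isolated. -/
theorem exists_core_of_almost [DecidableEq V] (G : SimpleGraph V) (A : Finset V) (v₀ : V)
    (hA : A.Nonempty) (h : ∀ z ∈ A, z ≠ v₀ → 2 ≤ degIn G A z)
    (h₀ : v₀ ∈ A → 1 ≤ degIn G A v₀) : ∃ U ⊆ A, IsCore G U := by
  -- Otherwise `A` induces a forest, with degree sum at most `2|A| - 2`, while the hypotheses force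
  -- at least `2(|A| - 1) + 1`, or `2|A|` if `v₀ ∉ A`.
  by_contra! hc
  have h1 := sum_degIn_add_two_le G A hA hc
  by_cases hv : v₀ ∈ A
  · rw [← Finset.sum_erase_add _ _ hv] at h1
    have h2 := Finset.card_nsmul_le_sum (A.erase v₀) (fun z => degIn G A z) 2 fun z hz =>
      h z (Finset.mem_of_mem_erase hz) (Finset.ne_of_mem_erase hz)
    rw [smul_eq_mul] at h2
    have := Finset.card_erase_add_one hv
    have := h₀ hv
    omega
  · have h2 := Finset.card_nsmul_le_sum A (fun z => degIn G A z) 2 fun z hz =>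
      h z hz (by rintro rfl; exact hv hz)
    rw [smul_eq_mul] at h2
    omega

/-- A core without smaller cores. -/
def IsMinCore (G : SimpleGraph V) (U : Finset V) : Prop :=
  IsCore G U ∧ ∀ U' ⊆ U, IsCore G U' → U' = U

theorem IsCore.exists_isMinCore {G : SimpleGraph V} {U : Finset V} (hU : IsCore G U) :
    ∃ U' ⊆ U, IsMinCore G U' := by
  induction hn : U.card using Nat.strong_induction_on generalizing U with
  | _ n ih =>
    subst hn
    by_cases hm : IsMinCore G U
    · exact ⟨U, subset_rfl, hm⟩
    · simp only [IsMinCore, hU, true_and, not_forall] at hm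
      obtain ⟨U', hs, hc, hne⟩ := hm
      obtain ⟨W, hW, hm⟩ := ih _ (Finset.card_lt_card (hs.ssubset_of_ne hne)) hc rfl
      exact ⟨W, hW.trans hs, hm⟩

/-- Let v have degree at least three and let w be a neighbour. Without the edge vw only w can fall
below degree two, and it keeps degree at least one, so a core survives; by minimality it is all of
U, hence w had degree at least three. As this holds for all neighbours of v, deleting v leaves a
smaller core. -/
theorem IsMinCore.degIn_eq_two {G : SimpleGraph V} {U : Finset V} (hU : IsMinCore G U) {v : V}
    (hv : v ∈ U) : degIn G U v = 2 := by
  classical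
  -- A neighbour of a vertex of degree at least three has degree at least three.
  have key : ∀ v ∈ U, 3 ≤ degIn G U v → ∀ w ∈ U, G.Adj v w → 3 ≤ degIn G U w := by
    intro v hv h3 w hw hvw
    let H := G.deleteEdges {s(v, w)}
    have hH : ∀ a b, H.Adj a b ↔ G.Adj a b ∧ s(a, b) ≠ s(v, w) := fun a b => by
      simp [H, SimpleGraph.deleteEdges_adj]
    have hne := hvw.ne
    have hdv : degIn H U v = degIn G (U.erase w) v := by
      unfold degIn
      congr 1
      ext z
      simp only [Finset.mem_filter, Finset.mem_erase, hH, ne_eq, Sym2.eq_iff]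
      grind
    have hdw : degIn H U w = degIn G (U.erase v) w := by
      unfold degIn
      congr 1
      ext z
      simp only [Finset.mem_filter, Finset.mem_erase, hH, ne_eq, Sym2.eq_iff]
      grind
    have hdz : ∀ z, z ≠ v → z ≠ w → degIn H U z = degIn G U z := by
      intro z h1 h2
      unfold degIn
      congr 1
      ext y
      simp only [Finset.mem_filter, hH, ne_eq, Sym2.eq_iff]
      grind
    have h1 := degIn_erase_add G hw v
    have h2 := degIn_erase_add G hv w
    simp only [hvw, hvw.symm, if_true] at h1 h2
    have h3w := hU.1.2 w hw
    obtain ⟨D, hD, hDc⟩ := exists_core_of_almost H U w ⟨v, hv⟩ (fun z hz hzw => by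
      by_cases hzv : z = v
      · subst hzv; omega
      · rw [hdz z hzv hzw]; exact hU.1.2 z hz) (fun _ => by omega)
    have hDG : IsCore G D :=
      ⟨hDc.1, fun z hz => (hDc.2 z hz).trans
        (degIn_mono_graph (fun a b hab => ((hH a b).1 hab).1) _ _)⟩
    have hDU := hU.2 D hD hDG
    subst hDU
    have := hDc.2 w hw
    omega
  by_contra hne
  have h3 : 3 ≤ degIn G U v := by have := hU.1.2 v hv; omega
  have hcore : IsCore G (U.erase v) := by
    refine ⟨?_, fun z hz => ?_⟩
    · obtain ⟨w, hw, hvw⟩ := exists_adj_of_degIn_pos (by omega : 1 ≤ degIn G U v)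
      exact ⟨w, Finset.mem_erase.2 ⟨hvw.ne', hw⟩⟩
    · rw [Finset.mem_erase] at hz
      have h1 := degIn_erase_add G hv z
      have h2 := hU.1.2 z hz.2
      by_cases hzv : G.Adj z v
      · have := key v hv h3 z hz.2 hzv.symm
        simp only [hzv, if_true] at h1
        omega
      · simp only [hzv, if_false] at h1
        omega
  have := hU.2 _ (Finset.erase_subset _ _) hcore
  exact Finset.notMem_erase v U (by rwa [this])

/-- The support of a cycle is a core. -/
theorem isCore_support_toFinset [DecidableEq V] {G : SimpleGraph V} {a : V} {p : G.Walk a a}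
    (hp : p.IsCycle) : IsCore G p.support.toFinset := by
  classical
  refine ⟨⟨a, by simp⟩, fun v hv => ?_⟩
  have h2 := hp.ncard_neighborSet_toSubgraph_eq_two (List.mem_toFinset.1 hv)
  rw [← h2, degIn, ← Set.ncard_coe_finset]
  refine Set.ncard_le_ncard (fun w hw => ?_) (Finset.finite_toSet _)
  have hw' : p.toSubgraph.Adj v w := hw
  have h3 : w ∈ p.support := by
    rw [← SimpleGraph.Walk.mem_verts_toSubgraph]; exact hw'.snd_mem
  simp [h3, hw'.adj_sub]

/-- A finite graph of minimum degree at least two has a cycle. -/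
theorem not_isAcyclic_of_two_neighbors {W : Type*} [Finite W] [Nonempty W] (H : SimpleGraph W)
    (h : ∀ v, ∀ z, ∃ w, H.Adj v w ∧ w ≠ z) : ¬ H.IsAcyclic := by
  intro hH
  classical
  have := Fintype.ofFinite W
  have key : ∀ n : ℕ, ∃ (u v : W) (p : H.Walk u v), p.IsPath ∧ p.length = n := by
    intro n
    induction n with
    | zero =>
      obtain ⟨u⟩ := ‹Nonempty W›
      exact ⟨u, u, .nil, by simp, rfl⟩
    | succ n ih =>
      obtain ⟨u, v, p, hp, hl⟩ := ih
      -- In an acyclic graph the only neighbour of the start `u` lying on the path is `p.snd`, so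
      -- any other neighbour extends it. Paths of every length would then exist in a finite graph.
      obtain ⟨w, hw, hne⟩ := h u p.snd
      refine ⟨w, v, .cons hw.symm p, ?_, by simp [hl]⟩
      rw [SimpleGraph.Walk.cons_isPath_iff]
      exact ⟨hp, fun hmem => hne (hH.eq_snd_of_adj_start hp hw hmem)⟩
  obtain ⟨u, v, p, hp, hl⟩ := key (Fintype.card W)
  exact absurd hp.length_lt (by omega)

theorem IsCore.not_isAcyclic_induce {G : SimpleGraph V} {U : Finset V} (hU : IsCore G U)
    {A : Set V} (hA : (U : Set V) ⊆ A) : ¬ (G.induce A).IsAcyclic := by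
  classical
  intro hac
  have hac' : (G.induce (U : Set V)).IsAcyclic :=
    hac.embedding (G.induceHomOfLE hA)
  have : Nonempty (U : Set V) := by
    obtain ⟨u, hu⟩ := hU.1
    exact ⟨⟨u, hu⟩⟩
  refine not_isAcyclic_of_two_neighbors _ (fun v z => ?_) hac'
  obtain ⟨w, hw, hne⟩ := Finset.exists_mem_ne (by exact hU.2 v.1 v.2) z.1
  rw [Finset.mem_filter] at hw
  exact ⟨⟨w, hw.1⟩, hw.2, fun h => hne (by rw [← h])⟩

theorem exists_core_of_not_isAcyclic_induce {G : SimpleGraph V} {A : Set V}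
    (h : ¬ (G.induce A).IsAcyclic) : ∃ U : Finset V, (U : Set V) ⊆ A ∧ IsCore G U := by
  classical
  simp only [SimpleGraph.IsAcyclic, not_forall, not_not] at h
  obtain ⟨a, p, hp⟩ := h
  let f := (SimpleGraph.Embedding.induce (G := G) A)
  have hq : (p.map f.toHom).IsCycle := hp.map f.injective
  refine ⟨_, ?_, isCore_support_toFinset hq⟩
  intro v hv
  simp only [List.coe_toFinset, SimpleGraph.Walk.support_map, List.mem_map,
    Set.mem_ofPred_eq] at hv
  obtain ⟨w, _, rfl⟩ := hv
  exact w.2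

theorem isFeedbackVertexSet_iff (G : SimpleGraph V) (S : Finset V) :
    IsFeedbackVertexSet G S ↔ ∀ U : Finset V, Disjoint U S → ¬ IsCore G U := by
  have hd : ∀ U : Finset V, Disjoint U S ↔ (U : Set V) ⊆ {v | v ∉ S} := fun U => by
    rw [Finset.disjoint_left]; rfl
  simp only [hd]
  refine ⟨fun h U hU hc => hc.not_isAcyclic_induce hU h, fun h => ?_⟩
  by_contra hn
  obtain ⟨U, hU, hc⟩ := exists_core_of_not_isAcyclic_induce hn
  exact h U hU hc

theorem IsCycleGraph.exists_core {G : SimpleGraph V} {U : Finset V}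
    (h : IsCycleGraph (G.induce (U : Set V))) : ∃ U' ⊆ U, IsCore G U' := by
  obtain ⟨a, p, hp, -⟩ := h
  obtain ⟨U', h1, h2⟩ := exists_core_of_not_isAcyclic_induce (G := G) (A := (U : Set V))
    (fun h => h p hp)
  exact ⟨U', Finset.coe_subset.1 h1, h2⟩

/-- The support of any cycle in G[U] is a core, hence all of U. Every vertex has degree two in G[U],
and the cycle already uses two edges there, so no edge is left over. -/
theorem IsMinCore.isCycleGraph {G : SimpleGraph V} {U : Finset V} (hU : IsMinCore G U) :
    IsCycleGraph (G.induce (U : Set V)) := by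
  classical
  have h := hU.1.not_isAcyclic_induce (A := (U : Set V)) subset_rfl
  simp only [SimpleGraph.IsAcyclic, not_forall, not_not] at h
  obtain ⟨a, p, hp⟩ := h
  refine ⟨a, p, hp, ?_⟩
  let f := (SimpleGraph.Embedding.induce (G := G) (U : Set V))
  have hq : (p.map f.toHom).IsCycle := hp.map f.injective
  have hsupp := hU.2 (p.map f.toHom).support.toFinset (by
    intro v hv
    simp only [SimpleGraph.Walk.support_map, List.mem_toFinset, List.mem_map] at hv
    obtain ⟨w, _, rfl⟩ := hv
    exact w.2) (isCore_support_toFinset hq)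
  have hall : ∀ v : (U : Set V), v ∈ p.support := by
    intro v
    have : v.1 ∈ (p.map f.toHom).support.toFinset := by rw [hsupp]; exact v.2
    simp only [SimpleGraph.Walk.support_map, List.mem_toFinset, List.mem_map] at this
    obtain ⟨w, hw, hwv⟩ := this
    have : w = v := Subtype.ext hwv
    exact this ▸ hw
  refine SimpleGraph.Subgraph.ext ?_ ?_
  · ext v
    simp [hall v]
  · ext v w
    refine ⟨fun h => h.adj_sub, fun h => ?_⟩
    have h' : (G.induce (U : Set V)).Adj v w := by simpa using h
    have h2 := hp.ncard_neighborSet_toSubgraph_eq_two (hall v)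
    have h3 : ((G.induce (U : Set V)).neighborSet v).ncard ≤ 2 := by
      rw [← hU.degIn_eq_two v.2, degIn, ← Set.ncard_coe_finset,
        ← Set.ncard_image_of_injective _ Subtype.val_injective]
      refine Set.ncard_le_ncard ?_ (Finset.finite_toSet _)
      rintro _ ⟨z, hz, rfl⟩
      have hz' : G.Adj v z := hz
      have := z.2
      simp only [Finset.coe_filter, Set.mem_ofPred_eq]
      exact ⟨this, hz'⟩
    have h4 := Set.eq_of_subset_of_ncard_le (p.toSubgraph.neighborSet_subset v)
      (by omega) (Set.toFinite _)
    have : w ∈ p.toSubgraph.neighborSet v := by rw [h4]; exact h'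
    exact this

end Core

end FVS

namespace FVS

/-! ### The local ratio argument -/

section LocalRatio

variable {V : Type*} [DecidableEq V]

/-- A set that cannot be separated spans at least as many edges as a tree. -/
theorem two_mul_card_le_sum_degIn (G : SimpleGraph V) (K : Finset V)
    (hK : ∀ A ⊆ K, A.Nonempty → A ≠ K → ∃ a ∈ A, ∃ b ∈ K, b ∉ A ∧ G.Adj a b) :
    2 * K.card ≤ ∑ v ∈ K, degIn G K v + 2 := by
  -- Grow a set inside `K` one vertex at a time along an edge leaving it; each new vertex adds at
  -- least two to the degree sum.
  have key : ∀ n, n + 1 ≤ K.card →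
      ∃ A ⊆ K, A.card = n + 1 ∧ 2 * A.card ≤ ∑ v ∈ A, degIn G A v + 2 := by
    intro n
    induction n with
    | zero =>
      intro h
      obtain ⟨v, hv⟩ := Finset.card_pos.1 h
      exact ⟨{v}, by simpa using hv, by simp, by simp⟩
    | succ n ih =>
      intro h
      obtain ⟨A, hA, hc, hs⟩ := ih (by omega)
      obtain ⟨a, ha, b, hb, hbA, hab⟩ := hK A hA (Finset.card_pos.1 (by omega))
        (by rintro rfl; omega)
      refine ⟨insert b A, Finset.insert_subset hb hA, by simp [hbA, hc], ?_⟩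
      rw [sum_degIn_erase G (Finset.mem_insert_self b A), Finset.erase_insert hbA,
        Finset.card_insert_of_notMem hbA]
      have := degIn_pos (Finset.mem_insert_of_mem ha : a ∈ insert b A) hab.symm
      omega
  rcases K.eq_empty_or_nonempty with rfl | hne
  · simp
  · have := hne.card_pos
    obtain ⟨A, hA, hc, hs⟩ := key (K.card - 1) (by omega)
    rwa [Finset.eq_of_subset_of_card_le hA (by omega)] at hs

/-- The set `F` is an inclusion-wise minimal feedback vertex set of `G[W]`. -/
structure IsMinimalHitting (G : SimpleGraph V) (W F : Finset V) : Prop where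
  subset : F ⊆ W
  hits : ∀ U ⊆ W, Disjoint U F → ¬ IsCore G U
  witness : ∀ f ∈ F, ∃ U ⊆ W, Disjoint U (F.erase f) ∧ IsCore G U

theorem IsMinimalHitting.mem_witness {G : SimpleGraph V} {W F U : Finset V}
    (h : IsMinimalHitting G W F) {f : V} (hU : U ⊆ W) (hd : Disjoint U (F.erase f))
    (hc : IsCore G U) : f ∈ U := by
  by_contra hf
  refine h.hits U hU ?_ hc
  rw [Finset.disjoint_left] at hd ⊢
  intro a ha haF
  exact hd ha (Finset.mem_erase.2 ⟨by rintro rfl; exact hf ha, haF⟩)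

/-- A cycle with at most one vertex of degree larger than two. -/
def IsSemidisjoint (G : SimpleGraph V) (W U : Finset V) : Prop :=
  IsMinCore G U ∧ ∃ v₀, ∀ z ∈ U, z ≠ v₀ → degIn G W z = 2

/-- Suppose F meets U in u ≠ v, with u not the exceptional vertex. A witness core D for u contains u
but not v. At every other vertex than v₀ of U ∩ D, both cores contain the only two neighbours in W,
so U ∩ D keeps degree two there and contains a core. Minimality of U makes this core all of U, so v
∈ D. -/
theorem IsMinimalHitting.card_inter_le_one {G : SimpleGraph V} {W F U : Finset V}
    (h : IsMinimalHitting G W F) (hUW : U ⊆ W) (hU : IsSemidisjoint G W U) :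
    (F ∩ U).card ≤ 1 := by
  obtain ⟨hU, v₀, hv₀⟩ := hU
  have key : ∀ u ∈ F ∩ U, ∀ v ∈ F ∩ U, u ≠ v → u ≠ v₀ → False := by
    intro u hu v hv huv hu₀
    rw [Finset.mem_inter] at hu hv
    obtain ⟨D, hD, hdis, hDc⟩ := h.witness u hu.1
    have huD := h.mem_witness hD hdis hDc
    have hvD : v ∉ D := fun hvD =>
      Finset.disjoint_left.1 hdis hvD (Finset.mem_erase.2 ⟨huv.symm, hv.1⟩)
    have hdeg : ∀ z ∈ U ∩ D, z ≠ v₀ → 2 ≤ degIn G (U ∩ D) z := by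
      intro z hz hz₀
      rw [Finset.mem_inter] at hz
      have h2 := hv₀ z hz.1 hz₀
      rw [← h2]
      refine (degIn_congr fun w hw => ⟨fun hwW => ?_, fun hwA => ?_⟩).le
      · exact Finset.mem_inter.2 ⟨hU.1.subset_of_full hUW hz.1 h2 hwW hw,
          hDc.subset_of_full hD hz.2 h2 hwW hw⟩
      · exact hUW (Finset.mem_inter.1 hwA).1
    have huA : u ∈ U ∩ D := Finset.mem_inter.2 ⟨hu.2, huD⟩
    obtain ⟨C, hC, hCc⟩ : ∃ C ⊆ U ∩ D, IsCore G C := by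
      by_cases h₀ : v₀ ∈ U ∩ D → 1 ≤ degIn G (U ∩ D) v₀
      · exact exists_core_of_almost G (U ∩ D) v₀ ⟨u, huA⟩ hdeg h₀
      -- Here `v₀` is isolated in `U ∩ D`, so deleting it changes no other degree.
      · push Not at h₀
        refine ⟨(U ∩ D).erase v₀, Finset.erase_subset _ _,
          ⟨u, Finset.mem_erase.2 ⟨hu₀, huA⟩⟩, fun z hz => ?_⟩
        rw [Finset.mem_erase] at hz
        refine (hdeg z hz.2 hz.1).trans (degIn_congr fun w hw => ?_).le
        rw [Finset.mem_erase]
        refine ⟨fun hwA => ⟨?_, hwA⟩, fun h => h.2⟩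
        rintro rfl
        have := degIn_pos hz.2 hw.symm
        omega
    have hCU := hU.2 C (hC.trans Finset.inter_subset_left) hCc
    subst hCU
    exact hvD (Finset.mem_inter.1 (hC hv.2)).2
  by_contra hcard
  obtain ⟨u, hu, v, hv, huv⟩ := Finset.one_lt_card.1 (not_le.1 hcard)
  by_cases hu₀ : u = v₀
  · exact key v hv u hu huv.symm (by rintro rfl; exact huv hu₀)
  · exact key u hu v hv huv hu₀

/-- The counting argument behind the local ratio step, for a union `T'` of components of the
forest `G[T]`. -/
theorem card_add_two_mul_card_le (G : SimpleGraph V) (W F T : Finset V) (hFW : F ⊆ W)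
    (hTW : T ⊆ W) (hFT : Disjoint F T) (hdeg : ∀ v ∈ W, 2 ≤ degIn G W v)
    (hT : ∀ U ⊆ T, ¬ IsCore G U) (hsd : ∀ U ⊆ W, ¬ IsSemidisjoint G W U)
    (T' : Finset V) (hT' : T' ⊆ T) (hcl : ∀ a ∈ T', ∀ b ∈ T, G.Adj a b → b ∈ T')
    (F' : Finset V) (hF' : F' ⊆ F) (hw : ∀ f ∈ F', ∃ U ⊆ insert f T', IsCore G U) :
    F'.card + 2 * T'.card ≤ ∑ v ∈ T', degIn G W v := by
  classical
  induction hn : T'.card using Nat.strong_induction_on generalizing T' F' with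
  | _ n ih =>
  subst hn
  have hmemF : ∀ f, ∀ S ⊆ T, ∀ U ⊆ insert f S, IsCore G U → f ∈ U := by
    intro f S hS U hU hc
    by_contra hf
    refine hT U (fun z hz => ?_) hc
    rcases Finset.mem_insert.1 (hU hz) with rfl | h
    · exact absurd hz hf
    · exact hS h
  rcases T'.eq_empty_or_nonempty with rfl | hne
  · have : F' = ∅ := by
      rw [Finset.eq_empty_iff_forall_notMem]
      intro f hf
      obtain ⟨U, hU, hc⟩ := hw f hf
      have hfU := hmemF f ∅ (by simp) U hU hc
      obtain ⟨w, hwU, hadj⟩ := exists_adj_of_degIn_pos (one_le_two.trans (hc.2 f hfU))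
      have := hU hwU
      simp only [insert_empty_eq, Finset.mem_singleton] at this
      exact hadj.ne this.symm
    simp [this]
  -- A smallest member `K` of `P` is a connected component of `G[T']`. `F₁` collects the vertices
  -- that close a cycle with `K` alone; the others are charged to `T' \ K` by induction.
  let P := T'.powerset.filter fun K => K.Nonempty ∧ ∀ a ∈ K, ∀ b ∈ T', G.Adj a b → b ∈ K
  obtain ⟨K, hKP, hKmin⟩ := Finset.exists_min_image P Finset.card
    ⟨T', by simp +contextual [P, hne]⟩
  simp only [P, Finset.mem_filter, Finset.mem_powerset] at hKP hKmin
  obtain ⟨hKT', hKne, hKcl⟩ := hKP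
  have hKT := hKT'.trans hT'
  have hKW := hKT.trans hTW
  let F₁ := F'.filter fun f => ∃ U ⊆ insert f K, IsCore G U
  let F₂ := F'.filter fun f => ¬ ∃ U ⊆ insert f K, IsCore G U
  have hFsum : F₁.card + F₂.card = F'.card := Finset.card_filter_add_card_filter_not _
  have hF₁F : F₁ ⊆ F := (Finset.filter_subset _ _).trans hF'
  have hrest : F₂.card + 2 * (T' \ K).card ≤ ∑ v ∈ T' \ K, degIn G W v := by
    refine ih _ (Finset.card_lt_card (Finset.sdiff_ssubset hKT' hKne)) _
      (Finset.sdiff_subset.trans hT') ?_ _ ((Finset.filter_subset _ _).trans hF') ?_ rfl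
    · intro a ha b hb hab
      rw [Finset.mem_sdiff] at ha ⊢
      exact ⟨hcl a ha.1 b hb hab, fun hbK => ha.2 (hKcl b hbK a ha.1 hab.symm)⟩
    · intro f hf
      simp only [F₂, Finset.mem_filter] at hf
      obtain ⟨U, hU, hc⟩ := hw f hf.1
      have hfU := hmemF f T' hT' U hU hc
      have hfT : f ∉ T := Finset.disjoint_left.1 hFT (hF' hf.1)
      have hsplit := degIn_sdiff_add G (Finset.inter_subset_left : U ∩ K ⊆ U) f
      -- With two neighbours in `U ∩ K`, `f` would form a core with it, since `K` is closed under
      -- adjacency in `T'`. Hence removing `K` from `U` costs `f` at most one neighbour and the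
      -- remaining vertices none.
      have hd1 : degIn G (U ∩ K) f ≤ 1 := by
        by_contra hd
        refine hf.2 ⟨insert f (U ∩ K), Finset.insert_subset_insert _ Finset.inter_subset_right,
          ⟨f, Finset.mem_insert_self _ _⟩, fun z hz => ?_⟩
        rcases Finset.mem_insert.1 hz with rfl | hz
        · exact (by omega : 2 ≤ degIn G (U ∩ K) z).trans
            (degIn_mono G (Finset.subset_insert _ _) z)
        · rw [Finset.mem_inter] at hz
          refine (hc.2 z hz.1).trans (degIn_congr fun w hw => ?_).le
          rw [Finset.mem_insert, Finset.mem_inter]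
          refine ⟨fun hwU => ?_, ?_⟩
          · rcases Finset.mem_insert.1 (hU hwU) with rfl | hwT
            · exact Or.inl rfl
            · exact Or.inr ⟨hwU, hKcl z hz.2 w hwT hw⟩
          · rintro (rfl | h)
            · exact hfU
            · exact h.1
      have hfD : f ∈ U \ (U ∩ K) := by
        rw [Finset.mem_sdiff, Finset.mem_inter]
        exact ⟨hfU, fun h => hfT (hKT h.2)⟩
      obtain ⟨C, hC, hCc⟩ := exists_core_of_almost G (U \ (U ∩ K)) f ⟨f, hfD⟩
        (fun z hz hzf => by
          simp only [Finset.mem_sdiff, Finset.mem_inter, not_and] at hz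
          refine (hc.2 z hz.1).trans (degIn_congr fun w hw => ?_).le
          simp only [Finset.mem_sdiff, Finset.mem_inter, not_and]
          refine ⟨fun hwU => ⟨hwU, fun _ hwK => hz.2 hz.1 ?_⟩, fun h => h.1⟩
          refine hKcl w hwK z ?_ hw.symm
          exact (Finset.mem_insert.1 (hU hz.1)).resolve_left hzf)
        (fun _ => by have := hc.2 f hfU; omega)
      refine ⟨C, fun z hz => ?_, hCc⟩
      have hzU := hC hz
      simp only [Finset.mem_sdiff, Finset.mem_inter, not_and] at hzU
      rcases Finset.mem_insert.1 (hU hzU.1) with rfl | hzT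
      · exact Finset.mem_insert_self _ _
      · exact Finset.mem_insert_of_mem (Finset.mem_sdiff.2 ⟨hzT, hzU.2 hzU.1⟩)
  have hK2 := Finset.card_nsmul_le_sum K (fun z => degIn G W z) 2 fun z hz => hdeg z (hKW hz)
  rw [smul_eq_mul] at hK2
  -- With `F₁` empty, minimum degree two suffices. With one vertex `f`, failure would force all
  -- degrees on `K` to be two, giving a semidisjoint cycle through `f`. Otherwise the tree `K`
  -- contributes at least `2|K| - 2` and the edges to `F₁` at least `2|F₁|`, enough once `|F₁| ≥ 2`.
  have hcomp : F₁.card + 2 * K.card ≤ ∑ v ∈ K, degIn G W v := by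
    rcases Nat.lt_trichotomy F₁.card 1 with h0 | h1 | h2
    · omega
    · by_contra hlt
      obtain ⟨f, hf⟩ := Finset.card_eq_one.1 h1
      have hfF₁ : f ∈ F₁ := by simp [hf]
      obtain ⟨U, hU, hc⟩ := (Finset.mem_filter.1 hfF₁).2
      obtain ⟨U', hU', hm⟩ := hc.exists_isMinCore
      have hsub : U' ⊆ insert f K := hU'.trans hU
      refine hsd U' (hsub.trans (Finset.insert_subset (hFW (hF₁F hfF₁)) hKW)) ⟨hm, f, ?_⟩
      intro z hz hzf
      have hzK := (Finset.mem_insert.1 (hsub hz)).resolve_left hzf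
      by_contra hne2
      have := Finset.sum_lt_sum (s := K) (f := fun _ => 2) (g := fun z => degIn G W z)
        (fun z hz => hdeg z (hKW hz))
        ⟨z, hzK, lt_of_le_of_ne (hdeg z (hKW hzK)) (Ne.symm hne2)⟩
      simp only [Finset.sum_const, smul_eq_mul] at this
      omega
    · have hdis : Disjoint K F₁ := by
        rw [Finset.disjoint_right]
        exact fun f hf hfK => Finset.disjoint_left.1 hFT (hF₁F hf) (hKT hfK)
      have e1 : ∑ v ∈ K, degIn G K v + ∑ v ∈ K, degIn G F₁ v ≤ ∑ v ∈ K, degIn G W v := by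
        rw [← Finset.sum_add_distrib]
        refine Finset.sum_le_sum fun v _ => ?_
        rw [← degIn_union_disjoint G hdis]
        exact degIn_mono G (Finset.union_subset hKW (hF₁F.trans hFW)) v
      have e2 := Finset.card_nsmul_le_sum F₁ (fun z => degIn G K z) 2 fun f hf => by
        obtain ⟨U, hU, hc⟩ := (Finset.mem_filter.1 hf).2
        have hfU := hmemF f K hKT U hU hc
        refine (hc.2 f hfU).trans ((degIn_mono G hU f).trans (degIn_congr fun w hw => ?_).le)
        simp [hw.ne']
      rw [smul_eq_mul, sum_degIn_comm] at e2
      have e3 := two_mul_card_le_sum_degIn G K fun A hA hAne hAK => by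
        by_contra! hno
        have hle := hKmin A ⟨hA.trans hKT', hAne, fun a ha b hb hab => by
          by_contra hbA
          exact hno a ha b (hKcl a (hA ha) b hb hab) hbA hab⟩
        exact hAK (Finset.eq_of_subset_of_card_le hA hle)
      omega
  have hs := Finset.sum_sdiff (f := fun z => degIn G W z) hKT'
  have hcard := Finset.card_sdiff_add_card_eq_card hKT'
  omega

/-- This is ∑_F (d(v) - 1) ≤ ∑_W (d(v) - 2) without subtraction. The counting argument applies to
the forest W \ F, since the witness core of f lies in W \ F together with f. -/
theorem IsMinimalHitting.sum_degIn_le {G : SimpleGraph V} {W F : Finset V}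
    (h : IsMinimalHitting G W F) (hdeg : ∀ v ∈ W, 2 ≤ degIn G W v)
    (hsd : ∀ U ⊆ W, ¬ IsSemidisjoint G W U) :
    ∑ v ∈ F, degIn G W v + 2 * W.card ≤ ∑ v ∈ W, degIn G W v + F.card := by
  have hmain := card_add_two_mul_card_le G W F (W \ F) h.subset Finset.sdiff_subset
    Finset.disjoint_sdiff hdeg
    (fun U hU => h.hits U (hU.trans Finset.sdiff_subset)
      (Finset.disjoint_of_subset_left hU Finset.sdiff_disjoint))
    hsd (W \ F) subset_rfl (fun _ _ b hb _ => hb) F subset_rfl (fun f hf => by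
      obtain ⟨U, hU, hd, hc⟩ := h.witness f hf
      refine ⟨U, fun z hz => ?_, hc⟩
      rw [Finset.mem_insert, Finset.mem_sdiff]
      by_contra! hcon
      exact Finset.disjoint_left.1 hd hz (Finset.mem_erase.2 ⟨hcon.1, hcon.2 (hU hz)⟩))
  have hs := Finset.sum_sdiff (f := fun z => degIn G W z) h.subset
  have hcard := Finset.card_sdiff_add_card_eq_card h.subset
  omega

theorem IsMinimalHitting.of_erase_of_degIn_le_one {G : SimpleGraph V} {W F : Finset V} {v : V}
    (h : IsMinimalHitting G (W.erase v) F) (hd : degIn G W v ≤ 1) : IsMinimalHitting G W F where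
  subset := h.subset.trans (Finset.erase_subset _ _)
  hits U hU hdis hc := by
    refine h.hits U (fun z hz => Finset.mem_erase.2 ⟨?_, hU hz⟩) hdis hc
    rintro rfl
    have := hc.2 z hz
    have := degIn_mono G hU z
    omega
  witness f hf := by
    obtain ⟨U, hU, h'⟩ := h.witness f hf
    exact ⟨U, hU.trans (Finset.erase_subset _ _), h'⟩

/-- Reverse deletion: v is added only if some core avoids F. That core is then its witness, and the
old witnesses remain valid because they avoid v. -/
theorem IsMinimalHitting.extend {G : SimpleGraph V} {W F : Finset V} {v : V} (hv : v ∈ W)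
    (h : IsMinimalHitting G (W.erase v) F) :
    IsMinimalHitting G W F ∨ (v ∉ F ∧ IsMinimalHitting G W (insert v F)) := by
  have hvF : v ∉ F := fun hvF => Finset.notMem_erase v W (h.subset hvF)
  by_cases hh : ∀ U ⊆ W, Disjoint U F → ¬ IsCore G U
  · refine Or.inl ⟨h.subset.trans (Finset.erase_subset _ _), hh, fun f hf => ?_⟩
    obtain ⟨U, hU, h'⟩ := h.witness f hf
    exact ⟨U, hU.trans (Finset.erase_subset _ _), h'⟩
  · push Not at hh
    refine Or.inr ⟨hvF, Finset.insert_subset hv (h.subset.trans (Finset.erase_subset _ _)),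
      fun U hU hdis hc => ?_, fun f hf => ?_⟩
    · rw [Finset.disjoint_insert_right] at hdis
      exact h.hits U (fun z hz => Finset.mem_erase.2
        ⟨by rintro rfl; exact hdis.1 hz, hU hz⟩) hdis.2 hc
    · rcases Finset.mem_insert.1 hf with rfl | hf
      · obtain ⟨U, hU, hd, hc⟩ := hh
        exact ⟨U, hU, by rwa [Finset.erase_insert hvF], hc⟩
      · obtain ⟨U, hU, hd, hc⟩ := h.witness f hf
        refine ⟨U, hU.trans (Finset.erase_subset _ _), ?_, hc⟩
        have hne : v ≠ f := by rintro rfl; exact hvF hf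
        rw [Finset.erase_insert_of_ne hne, Finset.disjoint_insert_right]
        exact ⟨fun hvU => Finset.notMem_erase v W (hU hvU), hd⟩

/-- Every point that satisfies the cycle inequalities and the weak density inequalities is at least
half as expensive as some minimal feedback vertex set. -/
theorem exists_isMinimalHitting_sum_le (G : SimpleGraph V) (x : V → ℝ) (hx : ∀ v, 0 ≤ x v)
    (hcyc : ∀ U : Finset V, IsMinCore G U → 1 ≤ ∑ u ∈ U, x u)
    (hwd : ∀ W : Finset V, ∑ v ∈ W, ((degIn G W v : ℝ) - 2) ≤
      2 * ∑ v ∈ W, ((degIn G W v : ℝ) - 1) * x v)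
    (W : Finset V) (c : V → ℝ) (hc : ∀ v ∈ W, 0 ≤ c v) :
    ∃ F, IsMinimalHitting G W F ∧ ∑ v ∈ F, c v ≤ 2 * ∑ v ∈ W, c v * x v := by
  -- Each step either deletes a vertex or turns a nonzero cost into zero.
  induction hn : W.card + (W.filter fun v => c v ≠ 0).card using Nat.strong_induction_on
    generalizing W c with
  | _ n ih =>
  subst hn
  have herase : ∀ v ∈ W, ∃ F, IsMinimalHitting G (W.erase v) F ∧
      ∑ u ∈ F, c u ≤ 2 * ∑ u ∈ W, c u * x u := by
    intro v hv
    obtain ⟨F, hF, hle⟩ := ih _ (by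
      have h1 := Finset.card_erase_lt_of_mem hv
      have h2 : ((W.erase v).filter fun v => c v ≠ 0).card ≤ (W.filter fun v => c v ≠ 0).card :=
        Finset.card_le_card (Finset.filter_subset_filter _ (Finset.erase_subset _ _))
      omega) (W.erase v) c (fun u hu => hc u (Finset.mem_of_mem_erase hu)) rfl
    refine ⟨F, hF, hle.trans ?_⟩
    have := Finset.sum_erase_add W (fun u => c u * x u) hv
    have := mul_nonneg (hc v hv) (hx v)
    linarith
  by_cases hlow : ∃ v ∈ W, degIn G W v ≤ 1
  · obtain ⟨v, hv, hd⟩ := hlow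
    obtain ⟨F, hF, hle⟩ := herase v hv
    exact ⟨F, hF.of_erase_of_degIn_le_one hd, hle⟩
  by_cases hzero : ∃ v ∈ W, c v = 0
  · obtain ⟨v, hv, hcv⟩ := hzero
    obtain ⟨F, hF, hle⟩ := herase v hv
    rcases hF.extend hv with h | ⟨hvF, h⟩
    · exact ⟨F, h, hle⟩
    · exact ⟨_, h, by rwa [Finset.sum_insert hvF, hcv, zero_add]⟩
  push Not at hlow hzero
  rcases W.eq_empty_or_nonempty with rfl | hne
  · exact ⟨∅, ⟨subset_rfl, fun U hU _ h => by
      obtain ⟨u, hu⟩ := h.1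
      exact absurd (hU hu) (Finset.notMem_empty u), by simp⟩, by simp⟩
  -- Local ratio: subtract `γ w` with the largest `γ` that keeps the costs nonnegative. The bound
  -- holds for the remaining costs by induction and for `w` by assumption, and the two add up.
  have step : ∀ w : V → ℝ, (∀ v ∈ W, 0 ≤ w v) → (∃ v ∈ W, 0 < w v) →
      (∀ F, IsMinimalHitting G W F → ∑ v ∈ F, w v ≤ 2 * ∑ v ∈ W, w v * x v) →
      ∃ F, IsMinimalHitting G W F ∧ ∑ v ∈ F, c v ≤ 2 * ∑ v ∈ W, c v * x v := by
    intro w hw hpos hF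
    obtain ⟨v₁, hv₁, hwv₁⟩ := hpos
    obtain ⟨v, hv, hmin⟩ := Finset.exists_min_image (W.filter fun v => 0 < w v)
      (fun v => c v / w v) ⟨v₁, by simp [hv₁, hwv₁]⟩
    rw [Finset.mem_filter] at hv
    set γ := c v / w v with hγ
    have hγ0 : 0 ≤ γ := div_nonneg (hc v hv.1) hv.2.le
    have hzero' : c v - γ * w v = 0 := by
      rw [hγ, div_mul_cancel₀ _ hv.2.ne', sub_self]
    obtain ⟨F, hFm, hle⟩ := ih (W.card + (W.filter fun u => c u - γ * w u ≠ 0).card) (by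
      have h1 : W.filter (fun u => c u ≠ 0) = W := Finset.filter_true_of_mem hzero
      have h2 : (W.filter fun u => c u - γ * w u ≠ 0) ⊂ W :=
        Finset.filter_ssubset.2 ⟨v, hv.1, by simpa using hzero'⟩
      have := Finset.card_lt_card h2
      rw [h1]
      omega) W (fun u => c u - γ * w u) (fun u hu => by
        rcases (hw u hu).eq_or_lt with h0 | h0
        · simp only [← h0, mul_zero, sub_zero]; exact hc u hu
        · have := hmin u (Finset.mem_filter.2 ⟨hu, h0⟩)
          rw [le_div_iff₀ h0] at this
          linarith) rfl
    refine ⟨F, hFm, ?_⟩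
    have h1 := mul_le_mul_of_nonneg_left (hF F hFm) hγ0
    have h2 : ∑ v ∈ F, (c v - γ * w v) = ∑ v ∈ F, c v - γ * ∑ v ∈ F, w v := by
      rw [Finset.sum_sub_distrib, Finset.mul_sum]
    have h3 : ∑ v ∈ W, (c v - γ * w v) * x v =
        ∑ v ∈ W, c v * x v - γ * ∑ v ∈ W, w v * x v := by
      rw [Finset.mul_sum, ← Finset.sum_sub_distrib]
      exact Finset.sum_congr rfl fun _ _ => by ring
    rw [h2, h3] at hle
    linarith
  by_cases hsd : ∃ U ⊆ W, IsSemidisjoint G W U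
  · obtain ⟨U, hUW, hU⟩ := hsd
    refine step (fun v => if v ∈ U then 1 else 0) (fun v _ => by split_ifs <;> simp)
      ?_ fun F hF => ?_
    · obtain ⟨u, hu⟩ := hU.1.1.1
      exact ⟨u, hUW hu, by simp [hu]⟩
    · have h1 : ((F ∩ U).card : ℝ) ≤ 1 := by exact_mod_cast hF.card_inter_le_one hUW hU
      have h2 := hcyc U hU.1
      simp only [Finset.sum_ite_mem, Finset.sum_const, nsmul_eq_mul, mul_one, ite_mul, one_mul,
        zero_mul, Finset.inter_eq_right.2 hUW]
      linarith
  · push Not at hsd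
    obtain ⟨u, hu⟩ := hne
    have hge : ∀ v ∈ W, (2 : ℝ) ≤ degIn G W v := fun v hv => by exact_mod_cast hlow v hv
    -- For these weights, `∑_W (d(v) - 2)` separates the cost of `F` from twice the cost of `x`.
    refine step (fun v => (degIn G W v : ℝ) - 1) (fun v hv => by linarith [hge v hv])
      ⟨u, hu, by linarith [hge u hu]⟩ fun F hF => ?_
    have h1 : (∑ v ∈ F, (degIn G W v : ℝ)) + 2 * W.card ≤ ∑ v ∈ W, (degIn G W v : ℝ) + F.card := by
      exact_mod_cast hF.sum_degIn_le (fun v hv => hlow v hv) hsd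
    have h2 := hwd W
    simp only [Finset.sum_sub_distrib, Finset.sum_const, nsmul_eq_mul, mul_one] at h2 ⊢
    linarith

end LocalRatio

end FVS

namespace FVS

/-! ### The orientation polyhedron -/

section Orientation

variable {V : Type*} (G : SimpleGraph V)

theorem degIn_cast [DecidableRel G.Adj] (A : Finset V) (v : V) :
    (degIn G A v : ℝ) = ∑ w ∈ A, if G.Adj v w then 1 else 0 := by
  rw [degIn_eq_sum]
  push_cast
  exact Finset.sum_congr rfl fun w _ => by congr

theorem sum_dart_eq [Fintype V] [DecidableEq V] [DecidableRel G.Adj]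
    (g : V → V → ℝ) (u : V) :
    ∑ a : G.Dart with a.fst = u, g a.fst a.snd = ∑ v, if G.Adj u v then g u v else 0 := by
  rw [← Finset.sum_filter]
  refine Finset.sum_bij (fun a _ => a.snd) ?_ ?_ ?_ ?_
  · rintro a ha
    simp only [Finset.mem_filter, Finset.mem_univ, true_and] at ha ⊢
    exact ha ▸ a.adj
  · rintro a ha b hb hab
    simp only [Finset.mem_filter, Finset.mem_univ, true_and] at ha hb
    exact SimpleGraph.Dart.ext _ _ (Prod.ext (ha.trans hb.symm) hab)
  · intro v hv
    simp only [Finset.mem_filter, Finset.mem_univ, true_and] at hv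
    exact ⟨⟨(u, v), hv⟩, by simp, rfl⟩
  · rintro a ha
    simp only [Finset.mem_filter, Finset.mem_univ, true_and] at ha
    rw [ha]

/-- The points of the orientation polyhedron satisfy the weak density inequalities. -/
theorem weak_density [Fintype V] [DecidableEq V] [DecidableRel G.Adj]
    {x : V → ℝ} (hx : x ∈ orientProjection G) (W : Finset V) :
    ∑ v ∈ W, ((degIn G W v : ℝ) - 2) ≤ 2 * ∑ v ∈ W, ((degIn G W v : ℝ) - 1) * x v := by
  obtain ⟨⟨x', y⟩, ⟨hedge, hvert, hx0, hy0⟩, rfl⟩ := hx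
  simp only at *
  set x := x'
  let g : V → V → ℝ := fun u v => if h : G.Adj u v then y ⟨(u, v), h⟩ else 0
  have hg : ∀ a : G.Dart, y a = g a.fst a.snd := fun a => by
    have := a.adj
    simp [g]
  have hg0 : ∀ u v, 0 ≤ g u v := fun u v => by
    by_cases h : G.Adj u v
    · simp only [g, h, dif_pos]; exact hy0 _
    · simp [g, h]
  have hE : ∀ u v, G.Adj u v → 1 ≤ x u + x v + g u v + g v u := fun u v h => by
    have := hedge ⟨(u, v), h⟩
    rw [hg, hg] at this
    exact this
  have hV : ∀ u, x u + ∑ v ∈ W, (if G.Adj u v then g u v else 0) ≤ 1 := fun u => by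
    have h1 := hvert u
    simp only [hg] at h1
    rw [sum_dart_eq] at h1
    have h2 : ∑ v ∈ W, (if G.Adj u v then g u v else 0) ≤
        ∑ v, if G.Adj u v then g u v else 0 :=
      Finset.sum_le_sum_of_subset_of_nonneg (Finset.subset_univ _) fun v _ _ => by
        split_ifs
        · exact hg0 u v
        · exact le_rfl
    linarith
  have hdx : ∑ u ∈ W, ∑ v ∈ W, (if G.Adj u v then x u else 0) =
      ∑ u ∈ W, (degIn G W u : ℝ) * x u := by
    refine Finset.sum_congr rfl fun u _ => ?_
    rw [degIn_cast, Finset.sum_mul]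
    exact Finset.sum_congr rfl fun v _ => by split_ifs <;> simp
  have hdx' : ∑ u ∈ W, ∑ v ∈ W, (if G.Adj u v then x v else 0) =
      ∑ u ∈ W, (degIn G W u : ℝ) * x u := by
    rw [← hdx, Finset.sum_comm]
    simp only [G.adj_comm]
  have hgg : ∑ u ∈ W, ∑ v ∈ W, (if G.Adj u v then g v u else 0) =
      ∑ u ∈ W, ∑ v ∈ W, (if G.Adj u v then g u v else 0) := by
    rw [Finset.sum_comm]
    simp only [G.adj_comm]
  -- Over ordered adjacent pairs the edge constraints sum to `∑ d ≤ 2 ∑ d x + 2 ∑ g`. The vertex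
  -- constraints, restricted to `W` since `y ≥ 0`, sum to `∑ x + ∑ g ≤ |W|`; twice this eliminates
  -- `g`.
  have hd : ∑ u ∈ W, (degIn G W u : ℝ) ≤ ∑ u ∈ W, ∑ v ∈ W, ((if G.Adj u v then x u else 0) +
      (if G.Adj u v then x v else 0) + (if G.Adj u v then g u v else 0) +
      (if G.Adj u v then g v u else 0)) := by
    refine Finset.sum_le_sum fun u _ => ?_
    rw [degIn_cast]
    refine Finset.sum_le_sum fun v _ => ?_
    split_ifs with h
    · exact hE u v h
    · simp
  have hVs := Finset.sum_le_sum fun u (_ : u ∈ W) => hV u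
  simp only [Finset.sum_add_distrib] at hd hVs
  rw [hdx, hdx', hgg] at hd
  simp only [sub_mul, one_mul, Finset.sum_sub_distrib, Finset.sum_const, nsmul_eq_mul,
    mul_one] at hVs ⊢
  linarith

/-- The edges of a forest can be assigned to their endpoints, at most one to each vertex. -/
theorem exists_parent [DecidableEq V] (T : Finset V) (hT : ∀ U ⊆ T, ¬ IsCore G U) :
    ∃ par : V → V, ∀ u ∈ T, ∀ v ∈ T, G.Adj u v → par u = v ∨ par v = u := by
  classical
  induction hn : T.card using Nat.strong_induction_on generalizing T with
  | _ n ih =>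
  subst hn
  rcases T.eq_empty_or_nonempty with rfl | hne
  · exact ⟨id, by simp⟩
  have := hT T subset_rfl
  simp only [IsCore, hne, true_and, not_forall, not_le] at this
  obtain ⟨t, ht, hd⟩ := this
  obtain ⟨par, hpar⟩ := ih _ (Finset.card_erase_lt_of_mem ht) (T.erase t)
    (fun U hU => hT U (hU.trans (Finset.erase_subset _ _))) rfl
  -- The vertex `t` has degree at most one; its only neighbour becomes its parent, and if there is
  -- none the value is irrelevant.
  have huniq : ∃ w, ∀ v ∈ T, G.Adj t v → w = v := by
    by_cases h : ∃ w ∈ T, G.Adj t w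
    · obtain ⟨w, hw, hadj⟩ := h
      refine ⟨w, fun v hv hv' => ?_⟩
      exact Finset.card_le_one.1 (Nat.lt_succ_iff.1 hd) w (by simp [hw, hadj]) v
        (by simp [hv, hv'])
    · push Not at h
      exact ⟨t, fun v hv hv' => absurd hv' (h v hv)⟩
  obtain ⟨w, hw⟩ := huniq
  refine ⟨Function.update par t w, fun u hu v hv huv => ?_⟩
  by_cases hut : u = t
  · subst hut
    left
    rw [Function.update_self]
    exact hw v hv huv
  by_cases hvt : v = t
  · subst hvt
    right
    rw [Function.update_self]
    exact hw u hu huv.symm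
  rw [Function.update_of_ne hut, Function.update_of_ne hvt]
  exact hpar u (Finset.mem_erase.2 ⟨hut, hu⟩) v (Finset.mem_erase.2 ⟨hvt, hv⟩) huv

/-- Each edge of the forest outside S is covered by an endpoint whose parent is the other one. A
vertex outside S spends its unit on its parent edge, a vertex of S on x. -/
theorem exists_integral_orientation [Fintype V] [DecidableEq V] [DecidableRel G.Adj]
    {S : Finset V} (hS : IsFeedbackVertexSet G S) :
    ∃ y : G.Dart → ℝ, (indicatorVector S, y) ∈ orientPolyhedron G ∧
      ∀ a, ∃ m : ℤ, y a = m := by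
  rw [isFeedbackVertexSet_iff] at hS
  obtain ⟨par, hpar⟩ := exists_parent G Sᶜ
    (fun U hU => hS U (Finset.disjoint_left.2 fun a ha => by simpa using hU ha))
  let g : V → V → ℝ := fun u v => if u ∉ S ∧ par u = v then 1 else 0
  have hg0 : ∀ u v, 0 ≤ g u v := fun u v => by simp only [g]; split_ifs <;> simp
  have hi0 : ∀ u, 0 ≤ indicatorVector S u := fun u => by
    unfold indicatorVector; split_ifs <;> simp
  refine ⟨fun a => g a.fst a.snd, ⟨fun a => ?_, fun u => ?_, hi0, fun a => hg0 _ _⟩,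
    fun a => ?_⟩
  · simp only [SimpleGraph.Dart.symm_toProd, Prod.fst_swap, Prod.snd_swap]
    have h1 := hi0 a.fst
    have h2 := hi0 a.snd
    have h3 := hg0 a.fst a.snd
    have h4 := hg0 a.snd a.fst
    by_cases hu : a.fst ∈ S
    · have : indicatorVector S a.fst = 1 := by simp [indicatorVector, hu]
      linarith
    by_cases hv : a.snd ∈ S
    · have : indicatorVector S a.snd = 1 := by simp [indicatorVector, hv]
      linarith
    rcases hpar a.fst (by simpa using hu) a.snd (by simpa using hv) a.adj with h | h
    · have : g a.fst a.snd = 1 := by simp [g, hu, h]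
      linarith
    · have : g a.snd a.fst = 1 := by simp [g, hv, h]
      linarith
  · simp only
    rw [sum_dart_eq]
    have hle : ∑ v, (if G.Adj u v then g u v else 0) ≤ ∑ v, g u v :=
      Finset.sum_le_sum fun v _ => by
        split_ifs
        · exact le_rfl
        · exact hg0 u v
    by_cases hu : u ∈ S
    · have : ∑ v, g u v = 0 := Finset.sum_eq_zero fun v _ => by simp [g, hu]
      have : indicatorVector S u = 1 := by simp [indicatorVector, hu]
      linarith
    · have : ∑ v, g u v = 1 := by simp [g, hu]
      have : indicatorVector S u = 0 := by simp [indicatorVector, hu]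
      linarith
  · simp only [g]
    split_ifs
    · exact ⟨1, by simp⟩
    · exact ⟨0, by simp⟩

/-- Gives compactness for the LP minimum, and forces integral x to be 0/1. -/
theorem orientPolyhedron_subset_Icc [Fintype V] [DecidableEq V] [DecidableRel G.Adj] : orientPolyhedron G ⊆ Set.Icc 0 1 := by
  rintro ⟨x, y⟩ ⟨-, hvert, hx, hy⟩
  simp only at *
  have hsum : ∀ u, 0 ≤ ∑ a : G.Dart with a.fst = u, y a := fun u =>
    Finset.sum_nonneg fun a _ => hy a
  refine ⟨⟨hx, hy⟩, fun u => ?_, fun a => ?_⟩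
  · have := hvert u
    have := hsum u
    simp only [Prod.fst_one, Pi.one_apply]
    linarith
  · have h1 := hvert a.fst
    have h2 := hx a.fst
    have h3 : y a ≤ ∑ b : G.Dart with b.fst = a.fst, y b :=
      Finset.single_le_sum (f := y) (fun b _ => hy b) (by simp)
    simp only [Prod.snd_one, Pi.one_apply]
    linarith

theorem isCompact_orientProjection [Fintype V] [DecidableEq V] [DecidableRel G.Adj] : IsCompact (orientProjection G) := by
  refine IsCompact.image ?_ continuous_fst
  refine isCompact_Icc.of_isClosed_subset ?_ (orientPolyhedron_subset_Icc G)
  simp only [orientPolyhedron, Set.ofPred_and, Set.ofPred_forall]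
  refine (isClosed_iInter fun a => ?_).inter ((isClosed_iInter fun u => ?_).inter
    ((isClosed_iInter fun u => ?_).inter (isClosed_iInter fun a => ?_)))
  all_goals exact isClosed_le (by fun_prop) (by fun_prop)

theorem isClosed_cycleCoverPolyhedron : IsClosed (cycleCoverPolyhedron G) := by
  simp only [cycleCoverPolyhedron, Set.ofPred_and, Set.ofPred_forall]
  refine (isClosed_iInter fun a => ?_).inter (isClosed_iInter fun U => isClosed_iInter fun _ => ?_)
  all_goals exact isClosed_le (by fun_prop) (by fun_prop)

/-- The integer points of the projection are the feedback vertex sets. -/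
theorem integral_projection_eq [Fintype V] [DecidableEq V] [DecidableRel G.Adj] :
    {x | x ∈ orientProjection G ∩ cycleCoverPolyhedron G ∧ ∀ u, ∃ m : ℤ, x u = m} =
      {x | ∃ S : Finset V, IsFeedbackVertexSet G S ∧ x = indicatorVector S} := by
  ext x
  constructor
  · rintro ⟨⟨hor, hcc⟩, hint⟩
    have h01 : ∀ u, x u = 0 ∨ x u = 1 := by
      intro u
      obtain ⟨q, hq, rfl⟩ := hor
      have hb := orientPolyhedron_subset_Icc G hq
      have h0 : 0 ≤ q.1 u := hb.1.1 u
      have h1 : q.1 u ≤ 1 := hb.2.1 u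
      obtain ⟨m, hm⟩ := hint u
      rw [hm] at h0 h1 ⊢
      have h0' : 0 ≤ m := by exact_mod_cast h0
      have h1' : m ≤ 1 := by exact_mod_cast h1
      have : m = 0 ∨ m = 1 := by omega
      rcases this with rfl | rfl <;> simp
    refine ⟨Finset.univ.filter fun u => x u = 1, ?_, ?_⟩
    · rw [isFeedbackVertexSet_iff]
      intro U hU hc
      obtain ⟨U', hU', hm⟩ := hc.exists_isMinCore
      have h1 := hcc.2 U' hm.isCycleGraph
      have h2 : ∑ u ∈ U', x u = 0 := Finset.sum_eq_zero fun u hu => by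
        refine (h01 u).resolve_right fun h => ?_
        exact Finset.disjoint_left.1 hU (hU' hu) (by simp [h])
      linarith
    · ext u
      unfold indicatorVector
      rcases h01 u with h | h <;> simp [h]
  · rintro ⟨S, hS, rfl⟩
    have hi0 : ∀ u, 0 ≤ indicatorVector S u := fun u => by
      unfold indicatorVector; split_ifs <;> simp
    refine ⟨⟨?_, hi0, fun U hU => ?_⟩, fun u => ?_⟩
    · obtain ⟨y, hy, -⟩ := exists_integral_orientation G hS
      exact ⟨_, hy, rfl⟩
    · obtain ⟨U', hU', hc⟩ := hU.exists_core
      have : ¬ Disjoint U' S := fun hd => (isFeedbackVertexSet_iff G S).1 hS U' hd hc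
      rw [Finset.not_disjoint_iff] at this
      obtain ⟨u, hu, huS⟩ := this
      have h1 := Finset.single_le_sum (f := indicatorVector S) (fun v _ => hi0 v) (hU' hu)
      have : indicatorVector S u = 1 := by simp [indicatorVector, huS]
      linarith
    · unfold indicatorVector
      split_ifs
      · exact ⟨1, by simp⟩
      · exact ⟨0, by simp⟩

end Orientation

/-! ### The distance formulation of the cycle inequalities -/

section Distance

variable {V : Type*}

theorem sum_toFinset_le_sum_map [DecidableEq V] {x : V → ℝ} (hx : ∀ v, 0 ≤ x v) (l : List V) :
    ∑ v ∈ l.toFinset, x v ≤ (l.map x).sum := by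
  induction l with
  | nil => simp
  | cons a l ih =>
    rw [List.toFinset_cons, List.map_cons, List.sum_cons]
    by_cases ha : a ∈ l.toFinset
    · rw [Finset.insert_eq_of_mem ha]
      linarith [hx a]
    · rw [Finset.sum_insert ha]
      linarith

theorem sum_map_support_eq {G : SimpleGraph V} (x : V → ℝ) {a b : V} (q : G.Walk a b) :
    (q.support.map x).sum = x a + (q.support.tail.map x).sum := by
  conv_lhs => rw [← SimpleGraph.Walk.cons_tail_support]
  rw [List.map_cons, List.sum_cons]

/-- The triangle inequalities along a walk. -/
theorem dist_le_of_walk {G : SimpleGraph V} {o : EndpointNaming G} {x : V → ℝ}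
    {d : V × CycleEdge G → ℝ} (h : (x, d) ∈ distPolyhedron G o) (e : CycleEdge G) {a b : V}
    (q : G.Walk a b) (hq : (e : Sym2 V) ∉ q.edges) :
    d (b, e) ≤ d (a, e) + (q.support.tail.map x).sum := by
  induction q with
  | nil => simp
  | @cons a c b hac q ih =>
    simp only [SimpleGraph.Walk.edges_cons, List.mem_cons, not_or] at hq
    have h1 := ih hq.2
    have h2 := h.2.2.2.2 ⟨(a, c), hac⟩ e (fun h => hq.1 h.symm)
    simp only [SimpleGraph.Walk.support_cons, List.tail_cons, sum_map_support_eq] at h1 h2 ⊢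
    linarith

/-- An edge on a cycle of G[U] is not a bridge there, so a path inside U joins its ends without it.
Both orders of the ends are covered, to suit any naming. -/
theorem exists_cycleEdge_path {G : SimpleGraph V} {U : Set V} (h : ¬ (G.induce U).IsAcyclic) :
    ∃ e : CycleEdge G, ∀ a b, s(a, b) = (e : Sym2 V) →
      ∃ q : G.Walk a b, q.IsPath ∧ (e : Sym2 V) ∉ q.edges ∧ ∀ v ∈ q.support, v ∈ U := by
  classical
  simp only [SimpleGraph.IsAcyclic, not_forall, not_not] at h
  obtain ⟨v, p, hp⟩ := h
  let f := SimpleGraph.Embedding.induce (G := G) U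
  have hedge : s(v, p.snd) ∈ p.edges := p.mk_start_snd_mem_edges hp.not_nil
  obtain ⟨hadj, hreach⟩ :=
    SimpleGraph.adj_and_reachable_delete_edges_iff_exists_cycle.2 ⟨v, p, hp, hedge⟩
  rw [SimpleGraph.reachable_deleteEdges_iff_exists_walk] at hreach
  obtain ⟨r, hr⟩ := hreach
  obtain ⟨r', hr'p, hr'⟩ : ∃ r' : (G.induce U).Walk v p.snd, r'.IsPath ∧ s(v, p.snd) ∉ r'.edges :=
    ⟨r.bypass, r.bypass_isPath, fun h => hr (r.edges_bypass_subset_edges h)⟩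
  let q : G.Walk (f.toHom v) (f.toHom p.snd) := r'.map f.toHom
  have hqp : q.IsPath := hr'p.map f.injective
  have hqe : s(f.toHom v, f.toHom p.snd) ∉ q.edges := by
    simp only [q, SimpleGraph.Walk.edges_map, List.mem_map, not_exists, not_and]
    intro e' he' heq
    have : Sym2.map f.toHom e' = Sym2.map f.toHom s(v, p.snd) := heq
    exact hr' (Sym2.map.injective f.injective this ▸ he')
  have hqs : ∀ w ∈ q.support, w ∈ U := by
    intro w hw
    simp only [q, SimpleGraph.Walk.support_map, List.mem_map] at hw
    obtain ⟨z, _, rfl⟩ := hw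
    exact z.2
  refine ⟨⟨s(f.toHom v, f.toHom p.snd), f.toHom v, p.map f.toHom, hp.map f.injective, ?_⟩, fun a b hab => ?_⟩
  · rw [SimpleGraph.Walk.edges_map, List.mem_map]
    exact ⟨_, hedge, rfl⟩
  · rcases Sym2.eq_iff.1 hab with ⟨rfl, rfl⟩ | ⟨rfl, rfl⟩
    · exact ⟨q, hqp, hqe, hqs⟩
    · exact ⟨q.reverse, hqp.reverse, by simpa using hqe, by simpa using hqs⟩

/-- The triangle inequalities along a path in U from s to t avoiding e bound d^e_t by the weight of
the path without s. With d^e_t + x_s ≥ 1 the whole path weighs at least one. -/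
theorem image_distPolyhedron_subset (G : SimpleGraph V) (o : EndpointNaming G) :
    Prod.fst '' distPolyhedron G o ⊆ cycleCoverPolyhedron G := by
  classical
  rintro _ ⟨⟨x, d⟩, h, rfl⟩
  refine ⟨h.1, fun U hU => ?_⟩
  obtain ⟨a, p, hp, -⟩ := hU
  obtain ⟨e, he⟩ := exists_cycleEdge_path (G := G) (U := (U : Set V)) (fun h => h p hp)
  obtain ⟨q, hq, hqe, hqU⟩ := he _ _ (o.eq_edge e)
  have h1 := dist_le_of_walk h e q hqe
  have h2 := h.2.2.1 e
  have h3 := h.2.2.2.1 e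
  have h4 := sum_map_support_eq x q
  rw [← List.sum_toFinset x hq.support_nodup] at h4
  have h5 : ∑ v ∈ q.support.toFinset, x v ≤ ∑ v ∈ U, x v :=
    Finset.sum_le_sum_of_subset_of_nonneg
      (fun v hv => hqU v (List.mem_toFinset.1 hv)) fun v _ _ => h.1 v
  simp only at *
  linarith

/-- The lengths, in the vertex weights `x`, of the walks from `o.s e` to `a` that avoid `e`,
together with the cap `1`. -/
def walkLengths (G : SimpleGraph V) (o : EndpointNaming G) (x : V → ℝ) (a : V)
    (e : CycleEdge G) : Set ℝ :=
  insert 1 {r | ∃ q : G.Walk (o.s e) a, (e : Sym2 V) ∉ q.edges ∧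
    r = (q.support.tail.map x).sum}

/-- Take d^e_a to be the capped shortest-path distance from s avoiding e. A walk from s to t
avoiding e closes up with e to a cycle, whose support contains a minimal core, of weight at least
one. -/
theorem subset_image_distPolyhedron (G : SimpleGraph V) (o : EndpointNaming G) :
    cycleCoverPolyhedron G ⊆ Prod.fst '' distPolyhedron G o := by
  classical
  rintro x ⟨hx, hcyc⟩
  have hnn : ∀ a e, ∀ r ∈ walkLengths G o x a e, 0 ≤ r := by
    rintro a e r (rfl | ⟨q, -, rfl⟩)
    · exact zero_le_one
    · refine List.sum_nonneg fun r hr => ?_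
      obtain ⟨v, -, rfl⟩ := List.mem_map.1 hr
      exact hx v
  have hbdd : ∀ a e, BddBelow (walkLengths G o x a e) := fun a e => ⟨0, hnn a e⟩
  -- The cap keeps the set nonempty even when `a` is unreachable, so every infimum is a genuine one.
  have hne : ∀ a e, (walkLengths G o x a e).Nonempty := fun a e => ⟨1, Set.mem_insert _ _⟩
  refine ⟨(x, fun i => sInf (walkLengths G o x i.1 i.2)), ⟨hx, fun i => ?_, fun e => ?_,
    fun e => ?_, fun a e hae => ?_⟩, rfl⟩
  · exact le_csInf (hne _ _) (hnn _ _)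
  · refine le_antisymm ?_ (le_csInf (hne _ _) (hnn _ _))
    exact csInf_le (hbdd _ _) (Or.inr ⟨.nil, by simp, by simp⟩)
  · rw [← sub_le_iff_le_add]
    refine le_csInf (hne _ _) ?_
    rintro r (rfl | ⟨q, hq, rfl⟩)
    · linarith [hx (o.s e)]
    · have hadj : G.Adj (o.t e) (o.s e) := by
        obtain ⟨a, p, -, hpe⟩ := e.2
        have := p.edges_subset_edgeSet hpe
        rw [← o.eq_edge e] at this
        exact (G.mem_edgeSet.1 this).symm
      have hc : (SimpleGraph.Walk.cons hadj (q.toPath : G.Walk _ _)).IsCycle := by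
        rw [SimpleGraph.Walk.cons_isCycle_iff]
        refine ⟨q.toPath.2, fun h => hq ?_⟩
        rw [← o.eq_edge e, Sym2.eq_swap]
        exact SimpleGraph.Walk.edges_toPath_subset_edges _ h
      obtain ⟨U, hU, hm⟩ := (isCore_support_toFinset hc).exists_isMinCore
      have hUq : U ⊆ q.support.toFinset := fun v hv => by
        have := hU hv
        rw [List.mem_toFinset, SimpleGraph.Walk.support_cons, List.mem_cons] at this
        rw [List.mem_toFinset]
        rcases this with rfl | h
        · exact q.end_mem_support
        · exact SimpleGraph.Walk.support_toPath_subset_support _ h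
      have h1 := hcyc U hm.isCycleGraph
      have h2 : ∑ v ∈ U, x v ≤ ∑ v ∈ q.support.toFinset, x v :=
        Finset.sum_le_sum_of_subset_of_nonneg hUq fun v _ _ => hx v
      have h3 := sum_toFinset_le_sum_map hx q.support
      rw [sum_map_support_eq] at h3
      linarith
  · simp only
    rw [← sub_le_iff_le_add]
    refine le_csInf (hne _ _) ?_
    rintro r (rfl | ⟨q, hq, rfl⟩)
    · have := csInf_le (hbdd a.snd e) (Set.mem_insert _ _)
      linarith [hx a.snd]
    · have := csInf_le (hbdd a.snd e) (Or.inr ⟨q.concat a.adj, by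
        rw [SimpleGraph.Walk.edges_concat, List.concat_eq_append, List.mem_append,
          List.mem_singleton]
        rintro (h | h)
        · exact hq h
        · exact hae h.symm, rfl⟩)
      rw [SimpleGraph.Walk.support_concat, List.tail_append_of_ne_nil (by simp)] at this
      simp only [List.map_append, List.sum_append, List.map_cons, List.map_nil, List.sum_cons,
        List.sum_nil, add_zero] at this
      linarith

theorem image_distPolyhedron (G : SimpleGraph V) (o : EndpointNaming G) :
    Prod.fst '' distPolyhedron G o = cycleCoverPolyhedron G :=
  (image_distPolyhedron_subset G o).antisymm (subset_image_distPolyhedron G o)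

/-- Distances can be rounded down if the vertex weights are integral. -/
theorem floor_mem_distPolyhedron {G : SimpleGraph V} {o : EndpointNaming G} {x : V → ℝ}
    {d : V × CycleEdge G → ℝ} (h : (x, d) ∈ distPolyhedron G o)
    (hx : ∀ u, ∃ m : ℤ, x u = m) : (x, fun i => (⌊d i⌋ : ℝ)) ∈ distPolyhedron G o := by
  obtain ⟨h1, h2, h3, h4, h5⟩ := h
  simp only at *
  refine ⟨h1, fun i => ?_, fun e => ?_, fun e => ?_, fun a e hae => ?_⟩
  · simp only
    exact_mod_cast Int.floor_nonneg.2 (h2 i)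
  · simp [h3]
  · have := h4 e
    obtain ⟨m, hm⟩ := hx (o.s e)
    simp only [hm] at this ⊢
    have : ((1 - m : ℤ) : ℝ) ≤ d (o.t e, e) := by push_cast; linarith
    have := Int.le_floor.2 this
    have : 1 ≤ ⌊d (o.t e, e)⌋ + m := by omega
    exact_mod_cast this
  · have := h5 a e hae
    obtain ⟨m, hm⟩ := hx a.snd
    simp only [hm] at this ⊢
    have := Int.floor_le_floor this
    rw [Int.floor_add_intCast] at this
    exact_mod_cast this

end Distance

end FVS

namespace FVS

/-! ### Cardinality bounds and the combinatorial optimum -/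

section Bounds

variable {V : Type*} (G : SimpleGraph V)

theorem abs_rhs_le (k : Con G) : |rhs G k| ≤ 4 := by
  rcases k with j | a | u | e | e | j <;> simp [rhs]

theorem card_cycleEdge_le [Fintype V] (o : EndpointNaming G) :
    Fintype.card (CycleEdge G) ≤ Fintype.card V ^ 2 := by
  rw [sq, ← Fintype.card_prod]
  refine Fintype.card_le_of_injective (fun e => (o.s e, o.t e)) fun e f hef => Subtype.ext ?_
  rw [Prod.mk.injEq] at hef
  rw [← o.eq_edge e, ← o.eq_edge f, hef.1, hef.2]

theorem card_dart_le [Fintype V] [DecidableRel G.Adj] : Fintype.card G.Dart ≤ Fintype.card V ^ 2 := by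
  rw [sq, ← Fintype.card_prod]
  exact Fintype.card_le_of_injective _ SimpleGraph.Dart.toProd_injective

theorem isFeedbackVertexSet_univ [Fintype V] : IsFeedbackVertexSet G Finset.univ := by
  rw [isFeedbackVertexSet_iff]
  rintro U hU ⟨⟨u, hu⟩, -⟩
  exact Finset.disjoint_left.1 hU hu (Finset.mem_univ u)

open Polynomial in
/-- A bound on the number of variables. -/
noncomputable def varBound : ℕ[X] := X + (X ^ 2 + X * X ^ 2)

open Polynomial in
/-- A bound on the number of inequalities. -/
noncomputable def conBound : ℕ[X] :=
  varBound + (X ^ 2 + (X + (X ^ 2 + (X ^ 2 + X ^ 2 * X ^ 2))))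

theorem card_var_le [Fintype V] [DecidableRel G.Adj] (o : EndpointNaming G) :
    Fintype.card (Var G) ≤ varBound.eval (Fintype.card V) := by
  have h1 := card_cycleEdge_le G o
  have h2 := card_dart_le G
  simp only [Fintype.card_sum, Fintype.card_prod, varBound, Polynomial.eval_add,
    Polynomial.eval_mul, Polynomial.eval_pow, Polynomial.eval_X]
  gcongr

theorem exists_isLeast_feedbackVertexSet [Fintype V] (c : V → ℝ) :
    ∃ opt, IsLeast {r | ∃ S : Finset V, IsFeedbackVertexSet G S ∧ r = ∑ u ∈ S, c u} opt := by
  classical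
  obtain ⟨S, hS, hmin⟩ := Finset.exists_min_image
    (Finset.univ.filter fun S => IsFeedbackVertexSet G S) (fun S => ∑ u ∈ S, c u)
    ⟨Finset.univ, by simpa using isFeedbackVertexSet_univ G⟩
  refine ⟨_, ⟨S, (Finset.mem_filter.1 hS).2, rfl⟩, ?_⟩
  rintro _ ⟨S', hS', rfl⟩
  exact hmin S' (by simpa using hS')

end Bounds

/-! ### The explicit system, its size and its solutions -/

section System

variable {V : Type*} [Fintype V] [DecidableEq V] (G : SimpleGraph V) [DecidableRel G.Adj]

theorem sum_cast_single_mul {ι : Type*} [Fintype ι] [DecidableEq ι] (j : ι) (z : ι → ℝ) :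
    ∑ i, (((Pi.single j 1 : ι → ℤ) i : ℤ) : ℝ) * z i = z j := by
  simp [Pi.single_apply]

theorem sum_xVar_mul (u : V) (z : Var G → ℝ) : ∑ i, (xVar G u i : ℝ) * z i = xPart z u :=
  sum_cast_single_mul _ z

theorem sum_yVar_mul (a : G.Dart) (z : Var G → ℝ) : ∑ i, (yVar G a i : ℝ) * z i = yPart z a :=
  sum_cast_single_mul _ z

theorem sum_dVar_mul (a : V) (e : CycleEdge G) (z : Var G → ℝ) :
    ∑ i, (dVar G a e i : ℝ) * z i = dPart z (a, e) :=
  sum_cast_single_mul _ z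

theorem system_polyhedron (o : EndpointNaming G) :
    (system G o).polyhedron =
      {z | (xPart z, yPart z) ∈ orientPolyhedron G ∧ (xPart z, dPart z) ∈ distPolyhedron G o} := by
  ext z
  have hpos : ∀ i, ∑ j, (((system G o).A (.inl i) j : ℤ) : ℝ) * z j = z i :=
    fun i => sum_cast_single_mul i z
  have hedge : ∀ a, ∑ j, (((system G o).A (.inr (.inl a)) j : ℤ) : ℝ) * z j =
      xPart z a.fst + xPart z a.snd + yPart z a + yPart z a.symm := fun a => by
    simp only [system, Matrix.of_apply, row, Pi.add_apply, Int.cast_add, add_mul,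
      Finset.sum_add_distrib, sum_xVar_mul, sum_yVar_mul]
  have hvert : ∀ u, ∑ j, (((system G o).A (.inr (.inr (.inl u))) j : ℤ) : ℝ) * z j =
      -xPart z u - ∑ a : G.Dart with a.fst = u, yPart z a := fun u => by
    simp only [system, Matrix.of_apply, row, Pi.sub_apply, Pi.neg_apply, Finset.sum_apply,
      Int.cast_sub, Int.cast_neg, Int.cast_sum, sub_mul, neg_mul, Finset.sum_mul,
      Finset.sum_sub_distrib, Finset.sum_neg_distrib, sum_xVar_mul]
    rw [Finset.sum_comm]
    simp only [sum_yVar_mul]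
  have hsrc : ∀ e, ∑ j, (((system G o).A (.inr (.inr (.inr (.inl e)))) j : ℤ) : ℝ) * z j =
      -dPart z (o.s e, e) := fun e => by
    simp only [system, Matrix.of_apply, row, Pi.neg_apply, Int.cast_neg, neg_mul,
      Finset.sum_neg_distrib, sum_dVar_mul]
  have htgt : ∀ e, ∑ j, (((system G o).A (.inr (.inr (.inr (.inr (.inl e))))) j : ℤ) : ℝ) * z j =
      dPart z (o.t e, e) + xPart z (o.s e) := fun e => by
    simp only [system, Matrix.of_apply, row, Pi.add_apply, Int.cast_add, add_mul,
      Finset.sum_add_distrib, sum_xVar_mul, sum_dVar_mul]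
  have htri : ∀ i, ∑ j, (((system G o).A (.inr (.inr (.inr (.inr (.inr i))))) j : ℤ) : ℝ) * z j =
      dPart z (i.1.1.fst, i.1.2) + xPart z i.1.1.snd - dPart z (i.1.1.snd, i.1.2) := fun i => by
    simp only [system, Matrix.of_apply, row, Pi.add_apply, Pi.sub_apply, Int.cast_add,
      Int.cast_sub, add_mul, sub_mul, Finset.sum_add_distrib, Finset.sum_sub_distrib,
      sum_xVar_mul, sum_dVar_mul]
  simp only [LinearSystem.polyhedron, Set.mem_ofPred_eq, Sum.forall, hpos, hedge, hvert, hsrc,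
    htgt, htri]
  simp only [system, rhs, Int.cast_zero, Int.cast_one, Int.cast_neg, orientPolyhedron,
    distPolyhedron, Set.mem_ofPred_eq]
  constructor
  · rintro ⟨⟨hx, hy, hd⟩, h1, h2, h3, h4, h5⟩
    refine ⟨⟨h1, fun u => by linarith [h2 u], hx, hy⟩, hx, hd, fun e => ?_, h4,
      fun a e hae => by linarith [h5 ⟨(a, e), hae⟩]⟩
    -- The equation `d^e_s = 0` is encoded as `-d^e_s ≥ 0` plus nonnegativity.
    exact le_antisymm (by linarith [h3 e]) (hd _)
  · rintro ⟨⟨h1, h2, hx, hy⟩, -, hd, h3, h4, h5⟩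
    exact ⟨⟨hx, hy, hd⟩, h1, fun u => by linarith [h2 u], fun e => by linarith [h3 e], h4,
      fun i => by linarith [h5 i.1.1 i.1.2 i.2]⟩

theorem abs_single_one_le {ι : Type*} [DecidableEq ι] (j i : ι) :
    |(Pi.single j 1 : ι → ℤ) i| ≤ 1 := by
  rw [Pi.single_apply]
  split_ifs <;> simp

theorem abs_row_le (o : EndpointNaming G) (k : Con G) (i : Var G) : |row G o k i| ≤ 4 := by
  have hx : ∀ u, |xVar G u i| ≤ 1 := fun u => abs_single_one_le _ i
  have hy : ∀ a, |yVar G a i| ≤ 1 := fun a => abs_single_one_le _ i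
  have hd : ∀ a e, |dVar G a e i| ≤ 1 := fun a e => abs_single_one_le _ i
  simp only [abs_le] at hx hy hd ⊢
  rcases k with j | a | u | e | e | j
  · have := abs_le.1 (abs_single_one_le j i)
    simp only [row]
    omega
  · have := hx a.fst
    have := hx a.snd
    have := hy a
    have := hy a.symm
    simp only [row, Pi.add_apply]
    omega
  · have hs : 0 ≤ ∑ a : G.Dart with a.fst = u, yVar G a i ∧
        ∑ a : G.Dart with a.fst = u, yVar G a i ≤ 1 := by
      rcases i with v | b | q
      · simp [yVar]
      · simp only [yVar, Pi.single_apply, Sum.inr.injEq, Sum.inl.injEq, Finset.sum_ite_eq]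
        split_ifs <;> simp
      · simp [yVar]
    have := hx u
    simp only [row, Pi.sub_apply, Pi.neg_apply, Finset.sum_apply]
    omega
  · have := hd (o.s e) e
    simp only [row, Pi.neg_apply]
    omega
  · have := hd (o.t e) e
    have := hx (o.s e)
    simp only [row, Pi.add_apply]
    omega
  · have := hd j.1.1.fst j.1.2
    have := hd j.1.1.snd j.1.2
    have := hx j.1.1.snd
    simp only [row, Pi.add_apply, Pi.sub_apply]
    omega

/-- Three bits for the absolute value and one for the sign. -/
theorem size_natAbs_add_one_le {m : ℤ} (h : |m| ≤ 4) : m.natAbs.size + 1 ≤ 4 := by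
  have : m.natAbs.size ≤ 3 := by
    rw [Nat.size_le]
    rw [abs_le] at h
    omega
  omega

theorem LinearSystem.size_le {ι κ : Type*} [Fintype ι] [Fintype κ] (S : LinearSystem ι κ)
    (hA : ∀ k i, |S.A k i| ≤ 4) (hb : ∀ k, |S.b k| ≤ 4) :
    S.size ≤ Fintype.card ι + Fintype.card κ +
      Fintype.card κ * (4 * Fintype.card ι + 4) := by
  refine Nat.add_le_add_left ?_ _
  rw [← smul_eq_mul, ← Finset.card_univ (α := κ)]
  refine Finset.sum_le_card_nsmul _ _ _ fun k _ => Nat.add_le_add ?_ (size_natAbs_add_one_le (hb k))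
  refine (Finset.sum_le_card_nsmul _ _ 4 fun i _ => size_natAbs_add_one_le (hA k i)).trans ?_
  rw [smul_eq_mul, Finset.card_univ, mul_comm]

theorem card_con_le (o : EndpointNaming G) :
    Fintype.card (Con G) ≤ conBound.eval (Fintype.card V) := by
  have h1 := card_cycleEdge_le G o
  have h2 := card_dart_le G
  have h3 := card_var_le G o
  have h4 : Fintype.card {i : G.Dart × CycleEdge G // i.1.edge ≠ (i.2 : Sym2 V)} ≤
      Fintype.card V ^ 2 * Fintype.card V ^ 2 := by
    refine (Fintype.card_subtype_le _).trans ?_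
    rw [Fintype.card_prod]
    gcongr
  have h5 : Fintype.card (Con G) = Fintype.card (Var G) + (Fintype.card G.Dart +
      (Fintype.card V + (Fintype.card (CycleEdge G) + (Fintype.card (CycleEdge G) +
        Fintype.card {i : G.Dart × CycleEdge G // i.1.edge ≠ (i.2 : Sym2 V)})))) := by
    simp only [Fintype.card_sum]
  rw [h5]
  simp only [conBound, Polynomial.eval_add, Polynomial.eval_mul, Polynomial.eval_pow,
    Polynomial.eval_X]
  gcongr

theorem system_size_le (o : EndpointNaming G) :
    (system G o).size ≤
      (varBound + conBound + conBound * (4 * varBound + 4)).eval (Fintype.card V) := by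
  refine ((system G o).size_le (abs_row_le G o) (abs_rhs_le G)).trans ?_
  have h1 := card_var_le G o
  have h2 := card_con_le G o
  simp only [Polynomial.eval_add, Polynomial.eval_mul, Polynomial.eval_ofNat]
  gcongr

/-- The variables y and d interact only through x, so solutions with equal x can be glued. -/
theorem image_xPart_polyhedron (o : EndpointNaming G) :
    xPart '' (system G o).polyhedron = orientProjection G ∩ cycleCoverPolyhedron G := by
  rw [system_polyhedron, ← image_distPolyhedron G o]
  ext x
  constructor
  · rintro ⟨z, ⟨h1, h2⟩, rfl⟩
    exact ⟨⟨_, h1, rfl⟩, ⟨_, h2, rfl⟩⟩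
  · rintro ⟨⟨⟨x', y⟩, h1, rfl⟩, ⟨⟨x'', d⟩, h2, h⟩⟩
    simp only at h
    subst h
    exact ⟨Sum.elim x'' (Sum.elim y d), ⟨h1, h2⟩, rfl⟩

/-- Integrality is needed in all variables: y comes from orienting the forest, d from rounding down
any feasible distances. -/
theorem image_xPart_integerPoints (o : EndpointNaming G) :
    xPart '' (system G o).integerPoints =
      {x | ∃ S : Finset V, IsFeedbackVertexSet G S ∧ x = indicatorVector S} := by
  refine Set.Subset.antisymm ?_ ?_
  · rintro _ ⟨z, ⟨hz, hint⟩, rfl⟩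
    rw [← integral_projection_eq, ← image_xPart_polyhedron G o]
    exact ⟨⟨z, hz, rfl⟩, fun u => hint _⟩
  · rintro x hx
    have hx' := hx
    rw [← integral_projection_eq, ← image_distPolyhedron G o] at hx'
    obtain ⟨⟨-, ⟨⟨x', d⟩, hd, rfl⟩⟩, hint⟩ := hx'
    obtain ⟨S, hS, hxS⟩ := hx
    obtain ⟨y, hy, hyint⟩ := exists_integral_orientation G hS
    rw [← hxS] at hy
    refine ⟨Sum.elim x' (Sum.elim y fun i => (⌊d i⌋ : ℝ)), ⟨?_, ?_⟩, rfl⟩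
    · rw [system_polyhedron]
      exact ⟨hy, floor_mem_distPolyhedron hd hint⟩
    · rintro (u | a | i)
      · exact hint u
      · exact hyint a
      · exact ⟨_, rfl⟩

theorem cost_indicatorVector (c : V → ℝ) (S : Finset V) :
    cost c (indicatorVector S) = ∑ u ∈ S, c u := by
  simp [cost, indicatorVector]

/-- Compactness is used after projecting to x, because the distance variables need not be bounded.
-/
theorem exists_isLeast_cost (c : V → ℝ) :
    ∃ x ∈ orientProjection G ∩ cycleCoverPolyhedron G,
      ∀ x' ∈ orientProjection G ∩ cycleCoverPolyhedron G, cost c x ≤ cost c x' := by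
  have hcont : Continuous (cost c) := by
    unfold cost
    fun_prop
  have hne : (orientProjection G ∩ cycleCoverPolyhedron G).Nonempty := by
    have : indicatorVector Finset.univ ∈
        {x | ∃ S : Finset V, IsFeedbackVertexSet G S ∧ x = indicatorVector S} :=
      ⟨_, isFeedbackVertexSet_univ G, rfl⟩
    rw [← integral_projection_eq] at this
    exact ⟨_, this.1⟩
  obtain ⟨x, hx, hmin⟩ := ((isCompact_orientProjection G).inter_right
    (isClosed_cycleCoverPolyhedron G)).exists_isMinOn hne hcont.continuousOn
  exact ⟨x, hx, fun x' hx' => hmin hx'⟩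

theorem exists_feedbackVertexSet_sum_le {x : V → ℝ}
    (hx : x ∈ orientProjection G ∩ cycleCoverPolyhedron G) {c : V → ℝ} (hc : ∀ u, 0 ≤ c u) :
    ∃ S : Finset V, IsFeedbackVertexSet G S ∧ ∑ u ∈ S, c u ≤ 2 * cost c x := by
  obtain ⟨F, hF, hle⟩ := exists_isMinimalHitting_sum_le G x hx.2.1
    (fun U hU => hx.2.2 U hU.isCycleGraph) (weak_density G hx.1) Finset.univ c fun v _ => hc v
  exact ⟨F, (isFeedbackVertexSet_iff G F).2 fun U hU => hF.hits U (Finset.subset_univ _) hU, hle⟩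

end System

end FVS

theorem theorem3 :
    ∃ p : Polynomial ℕ,
      ∀ (V : Type*) [Fintype V] [DecidableEq V] (G : SimpleGraph V) [DecidableRel G.Adj]
        (o : FVS.EndpointNaming G),
        -- the ILP has polynomial size
        (FVS.system G o).size ≤ p.eval (Fintype.card V) ∧
        -- its inequalities are those of the orientation and the distance polyhedron
        (FVS.system G o).polyhedron =
          {z | (FVS.xPart z, FVS.yPart z) ∈ FVS.orientPolyhedron G ∧
            (FVS.xPart z, FVS.dPart z) ∈ FVS.distPolyhedron G o} ∧
        -- the distance polyhedron is an extended formulation of the cycle cover polyhedron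
        Prod.fst '' FVS.distPolyhedron G o = FVS.cycleCoverPolyhedron G ∧
        FVS.xPart '' (FVS.system G o).polyhedron =
          FVS.orientProjection G ∩ FVS.cycleCoverPolyhedron G ∧
        -- the integer solutions are exactly the feedback vertex sets
        FVS.xPart '' (FVS.system G o).integerPoints =
          {x | ∃ S : Finset V, FVS.IsFeedbackVertexSet G S ∧ x = FVS.indicatorVector S} ∧
        {x | x ∈ FVS.orientProjection G ∩ FVS.cycleCoverPolyhedron G ∧ ∀ u, ∃ m : ℤ, x u = m} =
          {x | ∃ S : Finset V, FVS.IsFeedbackVertexSet G S ∧ x = FVS.indicatorVector S} ∧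
        -- the integrality gap is at most 2
        ∀ c : V → ℝ, (∀ u, 0 ≤ c u) →
          ∃ opt lp : ℝ,
            IsLeast {r | ∃ S : Finset V, FVS.IsFeedbackVertexSet G S ∧ r = ∑ u ∈ S, c u} opt ∧
            IsLeast {r | ∃ z ∈ (FVS.system G o).integerPoints, r = FVS.cost c (FVS.xPart z)} opt ∧
            IsLeast {r | ∃ z ∈ (FVS.system G o).polyhedron, r = FVS.cost c (FVS.xPart z)} lp ∧
            opt ≤ 2 * lp := by
  refine ⟨FVS.varBound + FVS.conBound + FVS.conBound * (4 * FVS.varBound + 4), ?_⟩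
  intro V _ _ G _ o
  refine ⟨FVS.system_size_le G o, FVS.system_polyhedron G o, FVS.image_distPolyhedron G o,
    FVS.image_xPart_polyhedron G o, FVS.image_xPart_integerPoints G o,
    FVS.integral_projection_eq G, fun c hc => ?_⟩
  obtain ⟨opt, hopt⟩ := FVS.exists_isLeast_feedbackVertexSet G c
  obtain ⟨x, hx, hmin⟩ := FVS.exists_isLeast_cost G c
  refine ⟨opt, FVS.cost c x, hopt, ?_, ⟨?_, ?_⟩, ?_⟩
  -- The integer solutions and the feedback vertex sets realise the same set of costs.
  · convert hopt using 1
    ext r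
    constructor
    · rintro ⟨z, hz, rfl⟩
      have hz' := Set.mem_image_of_mem FVS.xPart hz
      rw [FVS.image_xPart_integerPoints] at hz'
      obtain ⟨S, hS, hzS⟩ := hz'
      exact ⟨S, hS, by rw [hzS, FVS.cost_indicatorVector]⟩
    · rintro ⟨S, hS, rfl⟩
      have hS' : FVS.indicatorVector S ∈ FVS.xPart '' (FVS.system G o).integerPoints := by
        rw [FVS.image_xPart_integerPoints]
        exact ⟨S, hS, rfl⟩
      obtain ⟨z, hz, hzS⟩ := hS'
      exact ⟨z, hz, by rw [hzS, FVS.cost_indicatorVector]⟩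
  · rw [← FVS.image_xPart_polyhedron G o] at hx
    obtain ⟨z, hz, rfl⟩ := hx
    exact ⟨z, hz, rfl⟩
  · rintro _ ⟨z, hz, rfl⟩
    refine hmin _ ?_
    rw [← FVS.image_xPart_polyhedron G o]
    exact ⟨z, hz, rfl⟩
  · obtain ⟨S, hS, hle⟩ := FVS.exists_feedbackVertexSet_sum_le G hx hc
    exact (hopt.2 ⟨S, hS, rfl⟩).trans hle
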